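/- Let $\Omega$ be a topological space, let $F:\mathbb R^n\times\Omega\to\mathbb R^n$ and $q:\mathbb R^n\times\Omega\to\mathbb R^m$ be continuous, and let $P=\bigcup_{i=1}^pP_i\subset\mathbb R^m$ with convex polyhedra $P_i=\{y\mid a_{ij}^Ty\le b_{ij},\ j=1,\dots,m_i\}$. Put $\mathcal F(\omega)=\{x\mid q(x,\omega)\in P\}$ and $M_\omega(x)=q(x,\omega)-P$. **Notation.** For a set $\Gamma$ and $x\in\Gamma$ let - $T(x;\Gamma)=\{u\mid\exists\,t_k\downarrow0,\ u_k\to u:\ x+t_ku_k\in\Gamma\ \forall k\}$, - $\hat N(x;\Gamma)=\{\xi\mid\limsup_{x'\to x,\,x'\in\Gamma}\xi^T(x'-x)/\|x'-x\|\le0\}$, - $N(x;\Gamma)=\{\xi\mid\exists\,x_k\to x,\ \xi_k\to\xi:\ \xi_k\in\hat N(x_k;\Gamma)\ \forall k\}$, - $N(x;\Gamma;u)=\{\xi\mid\exists\,t_k\downarrow0,\ u_k\to u,\ \xi_k\to\xi:\ \xi_k\in\hat N(x+t_ku_k;\Gamma)\ \forall k\}$, all these sets being empty if $x\notin\Gamma$.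 A multifunction $M$ is metrically regular with modulus $\kappa>0$ around a point $(x_0,y_0)$ of its graph if $\operatorname{dist}(x,M^{-1}(y))\le\kappa\operatorname{dist}(y,M(x))$ for all $(x,y)$ near $(x_0,y_0)$, where $\operatorname{dist}(\cdot,\emptyset)=\infty$. Norms are Euclidean, with the operator norm for linear maps; $\mathbb B$ is the closed unit ball of $\mathbb R^n$. **Smoothness.** Let $\bar x\in\mathbb R^n$ and $\bar\omega\in\Omega$ with $\bar x\in\mathcal F(\bar\omega)$. Assume that there are neighborhoods $U_0$ of $\bar x$ and $W_0$ of $\bar\omega$ such that on $U_0\times W_0$ the mapping $q$ is twice and $F$ is once (Fréchet) differentiable with respect to $x$; $F,q,\nabla_xF,\nabla_xq,\nabla_x^2q$ are continuous at $(\bar x,\bar\omega)$; and $\nabla_x^2q(\cdot,\omega)$ is continuous on $U_0$ for every $\omega\in W_0$. **Solutions and error functions.** Let $$\hat S(\omega)=\{x\mid 0\in F(x,\omega)+\hat N(x;\mathcal F(\omega))\},\qquad \hat S_M(\omega)=\{x\mid0\in F(x,\omega)+\nabla_xq(x,\omega)^TN(q(x,\omega);P)\}$$ (B- and M-stationary solutions)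 and, for $l=1,2$, $$e_l(\omega)=\|\nabla_xq(\bar x,\omega)-\nabla_xq(\bar x,\bar\omega)\|+\|q(\bar x,\omega)-q(\bar x,\bar\omega)\|^{1/l},\qquad \hat\tau_l(\omega)=\|F(\bar x,\omega)-F(\bar x,\bar\omega)\|+e_l(\omega).$$ Property $R_l$ means: there are neighborhoods $U$ of $\bar x$, $W$ of $\bar\omega$ and constants $\kappa,\gamma>0$ such that for every $\omega\in W$ and every $x\in\mathcal F(\omega)\cap U$ with $\|x-\bar x\|>\gamma e_l(\omega)$ the multifunction $M_\omega$ is metrically regular with modulus $\kappa$ around $(x,0)$. For $(u,\lambda,\mu)\in\mathbb R^n\times\mathbb R^m\times\mathbb R^m$ consider the conditions $$\begin{aligned}&0\ne u,\quad\nabla_xq(\bar x,\bar\omega)u\in T(q(\bar x,\bar\omega);P),\\&\lambda\in N(q(\bar x,\bar\omega);P;\nabla_xq(\bar x,\bar\omega)u),\quad\mu\in T\bigl(\lambda;N(q(\bar x,\bar\omega);P;\nabla_xq(\bar x,\bar\omega)u)\bigr),\\&F(\bar x,\bar\omega)+\nabla_xq(\bar x,\bar\omega)^T\lambda=0,\\&\nabla_xF(\bar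 x,\bar\omega)u+\nabla_x^2(\lambda^Tq)(\bar x,\bar\omega)u+\nabla_xq(\bar x,\bar\omega)^T\mu=0.\end{aligned}\tag{A}$$ **Theorem.** 1. If $R_1$ holds and no triple $(u,\lambda,\mu)$ satisfies (A), then there are neighborhoods $U$ of $\bar x$, $W$ of $\bar\omega$ and a constant $L>0$ such that $$(\hat S(\omega)\cup\hat S_M(\omega))\cap U\subset\bar x+L\hat\tau_1(\omega)\mathbb B\qquad\forall\omega\in W.$$ 2. If $R_2$ holds and there is no quadruple $(u,\lambda,\mu,v)\in\mathbb R^n\times\mathbb R^m\times\mathbb R^m\times\mathbb R^n$ such that $(u,\lambda,\mu)$ satisfies (A) and $$\nabla_xq(\bar x,\bar\omega)v+u^T\nabla_x^2q(\bar x,\bar\omega)u\in T\Bigl(q(\bar x,\bar\omega);\bigcup_{i\in\mathcal I(u)}P_i\Bigr),\qquad u^T\nabla_x^2(\lambda^Tq)(\bar x,\bar\omega)u=F(\bar x,\bar\omega)^Tv,$$ where $\mathcal I(u)=\{i\mid\nabla_xq(\bar x,\bar\omega)u\in T(q(\bar x,\bar\omega);P_i)\}$, then there are neighborhoods $U$ of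 $\bar x$, $W$ of $\bar\omega$ and a constant $L>0$ such that $$(\hat S(\omega)\cup\hat S_M(\omega))\cap U\subset\bar x+L\hat\tau_2(\omega)\mathbb B\qquad\forall\omega\in W.$$ -/

import Mathlib

open Filter Topology

namespace DisjunctiveStability

section VariationalAnalysis

variable {E : Type*} [NormedAddCommGroup E] [InnerProductSpace ℝ E]

/-- The contingent (Bouligand tangent) cone `T(x; Γ)`; it is empty if `x ∉ Γ`. -/
def contingentCone (x : E) (Γ : Set E) : Set E :=
  {u | x ∈ Γ ∧ ∃ (t : ℕ → ℝ) (w : ℕ → E), (∀ k, 0 < t k) ∧ Tendsto t atTop (𝓝 0) ∧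
    Tendsto w atTop (𝓝 u) ∧ ∀ k, x + t k • w k ∈ Γ}

/-- The regular (Fréchet) normal cone `N̂(x; Γ)`; it is empty if `x ∉ Γ`. The `ε`-formulation
says that the `limsup` of `⟪ξ, x' - x⟫ / ‖x' - x‖` as `x' → x`, `x' ∈ Γ`, is at most `0`. -/
def regularNormalCone (x : E) (Γ : Set E) : Set E :=
  {ξ | x ∈ Γ ∧ ∀ ε : ℝ, 0 < ε → ∀ᶠ x' in 𝓝[Γ] x, inner ℝ ξ (x' - x) ≤ ε * ‖x' - x‖}

/-- The limiting (Mordukhovich) normal cone `N(x; Γ)`; it is empty if `x ∉ Γ`. -/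
def limitingNormalCone (x : E) (Γ : Set E) : Set E :=
  {ξ | x ∈ Γ ∧ ∃ (z ζ : ℕ → E), Tendsto z atTop (𝓝 x) ∧ Tendsto ζ atTop (𝓝 ξ) ∧
    ∀ k, ζ k ∈ regularNormalCone (z k) Γ}

/-- The limiting normal cone `N(x; Γ; u)` to `Γ` at `x` in direction `u`. -/
def directionalNormalCone (x : E) (Γ : Set E) (u : E) : Set E :=
  {ξ | x ∈ Γ ∧ ∃ (t : ℕ → ℝ) (w ζ : ℕ → E), (∀ k, 0 < t k) ∧ Tendsto t atTop (𝓝 0) ∧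
    Tendsto w atTop (𝓝 u) ∧ Tendsto ζ atTop (𝓝 ξ) ∧
    ∀ k, ζ k ∈ regularNormalCone (x + t k • w k) Γ}

end VariationalAnalysis

/-- A multifunction `M` is metrically regular with modulus `κ` around `(x̄, ȳ) ∈ gph M`:
`dist (x, M⁻¹(y)) ≤ κ dist (y, M(x))` for all `(x, y)` near `(x̄, ȳ)`. Distances take values in
`[0, ∞]`, the distance to the empty set being `∞`. -/
def MetricallyRegularAround {X Y : Type*} [PseudoEMetricSpace X] [PseudoEMetricSpace Y]
    (M : X → Set Y) (κ : ℝ) (x₀ : X) (y₀ : Y) : Prop :=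
  0 < κ ∧ y₀ ∈ M x₀ ∧ ∃ U ∈ 𝓝 x₀, ∃ V ∈ 𝓝 y₀, ∀ x ∈ U, ∀ y ∈ V,
    Metric.infEDist x {x' | y ∈ M x'} ≤ ENNReal.ofReal κ * Metric.infEDist y (M x)

/-- The convex polyhedron `{y | ⟪a j, y⟫ ≤ b j for all j}`. -/
def polyhedron {Y : Type*} [NormedAddCommGroup Y] [InnerProductSpace ℝ Y] {r : ℕ}
    (a : Fin r → Y) (b : Fin r → ℝ) : Set Y :=
  {y | ∀ j, inner ℝ (a j) y ≤ b j}

/-- `ℝⁿ` with the Euclidean norm. -/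
abbrev Vec (n : ℕ) : Type := EuclideanSpace ℝ (Fin n)

section Problem

variable {n m : ℕ} {Ω : Type*}

/-- `∇ₓ g (x, ω)`. -/
noncomputable def partialDeriv {Z : Type*} [NormedAddCommGroup Z] [NormedSpace ℝ Z]
    (g : Vec n → Ω → Z) (x : Vec n) (ω : Ω) : Vec n →L[ℝ] Z :=
  fderiv ℝ (fun x' => g x' ω) x

/-- `∇ₓ² g (x, ω)`, as a bilinear map: `uᵀ ∇ₓ² g (x, ω) w = partialDeriv₂ g x ω u w`. -/
noncomputable def partialDeriv₂ {Z : Type*} [NormedAddCommGroup Z] [NormedSpace ℝ Z]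
    (g : Vec n → Ω → Z) (x : Vec n) (ω : Ω) : Vec n →L[ℝ] Vec n →L[ℝ] Z :=
  fderiv ℝ (fun x' => partialDeriv g x' ω) x

/-- `∇ₓ g (x, ω)ᵀ η`. -/
noncomputable def partialDerivT (g : Vec n → Ω → Vec m) (x : Vec n) (ω : Ω) (η : Vec m) : Vec n :=
  ContinuousLinearMap.adjoint (partialDeriv g x ω) η

/-- `∇ₓ² (ηᵀ g) (x, ω) u`: the derivative in direction `u` of the gradient of the scalar
function `x ↦ ηᵀ g (x, ω)`. -/
noncomputable def scalarizedHessian (g : Vec n → Ω → Vec m) (η : Vec m) (x : Vec n) (ω : Ω) (u : Vec n) : Vec n :=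
  fderiv ℝ (gradient fun x' => (inner ℝ η (g x' ω) : ℝ)) x u

/-- The standing smoothness assumption on the data at the reference point `(x₀, ω₀)`. -/
def BasicAssumption [TopologicalSpace Ω] (F : Vec n → Ω → Vec n) (q : Vec n → Ω → Vec m) (x₀ : Vec n) (ω₀ : Ω) :
    Prop :=
  ∃ U ∈ 𝓝 x₀, ∃ W ∈ 𝓝 ω₀,
    (∀ x ∈ U, ∀ ω ∈ W,
      DifferentiableAt ℝ (fun x' => F x' ω) x ∧
      DifferentiableAt ℝ (fun x' => q x' ω) x ∧
      DifferentiableAt ℝ (fun x' => partialDeriv q x' ω) x) ∧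
    ContinuousAt (fun z : Vec n × Ω => F z.1 z.2) (x₀, ω₀) ∧
    ContinuousAt (fun z : Vec n × Ω => q z.1 z.2) (x₀, ω₀) ∧
    ContinuousAt (fun z : Vec n × Ω => partialDeriv F z.1 z.2) (x₀, ω₀) ∧
    ContinuousAt (fun z : Vec n × Ω => partialDeriv q z.1 z.2) (x₀, ω₀) ∧
    ContinuousAt (fun z : Vec n × Ω => partialDeriv₂ q z.1 z.2) (x₀, ω₀) ∧
    ∀ ω ∈ W, ContinuousOn (fun x => partialDeriv₂ q x ω) U

/-- The feasible set `𝓕(ω) = {x | q (x, ω) ∈ P}`. -/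
def feasibleSet (q : Vec n → Ω → Vec m) (P : Set (Vec m)) (ω : Ω) : Set (Vec n) :=
  {x | q x ω ∈ P}

/-- The constraint multifunction `M_ω (x) = q (x, ω) - P`. -/
def constraintMap (q : Vec n → Ω → Vec m) (P : Set (Vec m)) (ω : Ω) (x : Vec n) : Set (Vec m) :=
  {y | ∃ z ∈ P, y = q x ω - z}

/-- The linearized cone `T^lin_ω (x)`. -/
def linearizedCone (q : Vec n → Ω → Vec m) (P : Set (Vec m)) (ω : Ω) (x : Vec n) : Set (Vec n) :=
  {u | partialDeriv q x ω u ∈ contingentCone (q x ω) P}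

/-- The solution set `Ŝ(ω)` of `0 ∈ F (x, ω) + N̂(x; 𝓕(ω))` (B-stationary solutions). -/
def solutionsB (F : Vec n → Ω → Vec n) (q : Vec n → Ω → Vec m) (P : Set (Vec m)) (ω : Ω) : Set (Vec n) :=
  {x | ∃ ξ ∈ regularNormalCone x (feasibleSet q P ω), F x ω + ξ = 0}

/-- The solution set `Ŝ_M(ω)` of `0 ∈ F (x, ω) + ∇ₓ q (x, ω)ᵀ N(q (x, ω); P)`
(M-stationary solutions). -/
def solutionsM (F : Vec n → Ω → Vec n) (q : Vec n → Ω → Vec m) (P : Set (Vec m)) (ω : Ω) : Set (Vec n) :=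
  {x | ∃ η ∈ limitingNormalCone (q x ω) P, F x ω + partialDerivT q x ω η = 0}

/-- `e_l(ω) = ‖∇ₓ q (x₀, ω) - ∇ₓ q (x₀, ω₀)‖ + ‖q (x₀, ω) - q (x₀, ω₀)‖ ^ (1 / l)`. -/
noncomputable def errE (q : Vec n → Ω → Vec m) (x₀ : Vec n) (ω₀ : Ω) (l : ℕ) (ω : Ω) : ℝ :=
  ‖partialDeriv q x₀ ω - partialDeriv q x₀ ω₀‖ + ‖q x₀ ω - q x₀ ω₀‖ ^ (1 / (l : ℝ))

/-- `τ̂_l(ω) = ‖F (x₀, ω) - F (x₀, ω₀)‖ + e_l(ω)`. -/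
noncomputable def errTau (F : Vec n → Ω → Vec n) (q : Vec n → Ω → Vec m) (x₀ : Vec n) (ω₀ : Ω) (l : ℕ) (ω : Ω) : ℝ :=
  ‖F x₀ ω - F x₀ ω₀‖ + errE q x₀ ω₀ l ω

/-- Property `R_l`. -/
def PropertyR [TopologicalSpace Ω] (q : Vec n → Ω → Vec m) (P : Set (Vec m)) (x₀ : Vec n) (ω₀ : Ω) (l : ℕ) : Prop :=
  ∃ U ∈ 𝓝 x₀, ∃ W ∈ 𝓝 ω₀, ∃ κ > 0, ∃ γ > 0, ∀ ω ∈ W, ∀ x ∈ feasibleSet q P ω ∩ U,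
    γ * errE q x₀ ω₀ l ω < ‖x - x₀‖ → MetricallyRegularAround (constraintMap q P ω) κ x 0

/-- The conditions on the triple `(u, η, μ)` that are excluded in the Lipschitz case. -/
def CriticalTriple (F : Vec n → Ω → Vec n) (q : Vec n → Ω → Vec m) (P : Set (Vec m)) (x₀ : Vec n) (ω₀ : Ω)
    (u : Vec n) (η μ : Vec m) : Prop :=
  u ≠ 0 ∧ u ∈ linearizedCone q P ω₀ x₀ ∧
  η ∈ directionalNormalCone (q x₀ ω₀) P (partialDeriv q x₀ ω₀ u) ∧
  μ ∈ contingentCone η (directionalNormalCone (q x₀ ω₀) P (partialDeriv q x₀ ω₀ u)) ∧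
  F x₀ ω₀ + partialDerivT q x₀ ω₀ η = 0 ∧
  partialDeriv F x₀ ω₀ u + scalarizedHessian q η x₀ ω₀ u + partialDerivT q x₀ ω₀ μ = 0

/-- The conditions on `v` that are added in the Hölder case. The union runs over the index set
`𝓘(u)` of those `i` for which `∇ₓ q (x₀, ω₀) u` is tangent to `Q i` at `q (x₀, ω₀)`. -/
def SecondOrderTangency (F : Vec n → Ω → Vec n) (q : Vec n → Ω → Vec m) {p : ℕ} (Q : Fin p → Set (Vec m))
    (x₀ : Vec n) (ω₀ : Ω) (u : Vec n) (η : Vec m) (v : Vec n) : Prop :=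
  partialDeriv q x₀ ω₀ v + partialDeriv₂ q x₀ ω₀ u u ∈ contingentCone (q x₀ ω₀)
    (⋃ i ∈ {i : Fin p | partialDeriv q x₀ ω₀ u ∈ contingentCone (q x₀ ω₀) (Q i)}, Q i) ∧
  inner ℝ u (scalarizedHessian q η x₀ ω₀ u) = inner ℝ (F x₀ ω₀) v

/-- `Ŝ(ω) ∪ Ŝ_M(ω)` is, near `x₀` and for all `ω` near `ω₀`, contained in the closed ball
around `x₀` of radius `L * τ̂_l(ω)`. -/
def UpperStable [TopologicalSpace Ω] (F : Vec n → Ω → Vec n) (q : Vec n → Ω → Vec m) (P : Set (Vec m))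
    (x₀ : Vec n) (ω₀ : Ω) (l : ℕ) : Prop :=
  ∃ U ∈ 𝓝 x₀, ∃ W ∈ 𝓝 ω₀, ∃ L > 0, ∀ ω ∈ W,
    (solutionsB F q P ω ∪ solutionsM F q P ω) ∩ U ⊆
      Metric.closedBall x₀ (L * errTau F q x₀ ω₀ l ω)

end Problem

end DisjunctiveStability

/-!
The estimate is proved by contradiction. If it fails, there is an ultrafilter converging to
`(x₀, ω₀)` on solutions `x ≠ x₀` for which `τ̂_l(ω)` is of smaller order than `t = ‖x - x₀‖`
(`exists_ultrafilter_of_not_upperStable`); all limits of bounded quantities then exist without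
passing to subsequences. In particular `(x - x₀) / t` converges to a unit vector `u`.

As `γ e_l(ω) < t` eventually, property `R_l` makes the constraints metrically regular at `x`. This
bounds the multipliers of M-stationary solutions (`norm_le_of_metricallyRegularAround`), and a
quadratic penalty argument provides multipliers for B-stationary solutions as well
(`exists_approx_multiplier`). Both kinds of solutions thus yield points `z ∈ P` within `t ^ 3` of
`q (x, ω)` and bounded regular normals `ζ ∈ N̂(z; P)` that solve the stationarity equation up to
`t ^ 3`. Let `η = lim ζ`.

A finite union of polyhedra has only finitely many regular normal cones, each of them polyhedral
(`finite_regularNormalCones`, `isPolyhedralCone_regularNormalCone`). Along the ultrafilter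
`N̂(z; P)` is therefore a fixed cone `C`, and `C ⊆ N(q (x₀, ω₀); P; ∇q u)` by definition of the
directional normal cone. With `A = ∇q (x₀, ω₀)`, the difference of the stationarity equations at
`x` and `x₀`, divided by `t`, shows that `-(∇F u + ∇²(ηᵀ q) u)` is the limit of `Aᵀ (ζ - η) / t`.
Here `ζ - η` lies in a polyhedral cone contained in `T(η; C)`, whose image under `Aᵀ` is closed, so
the limit equals `Aᵀ μ` for some tangent `μ`. Working with this image rather than with the quotients
`(ζ - η) / t`, which may be unbounded, is the main point.

For `l = 2`, the points `z` eventually lie in one polyhedron `P i`, and `⟪η, z - q (x₀, ω₀)⟫ = 0`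
because `P i` is conical near `q (x₀, ω₀)`. The second-order expansion of `q` exhibits
`uᵀ ∇²q u` as a limit of points `w - A v` with `w` in a polyhedral cone of tangents to `P i`
orthogonal to `η`. Closedness of the image of that cone gives `v` with
`A v + uᵀ ∇²q u = w`, and `⟪η, w⟫ = 0` is the remaining equation.

Closedness of linear images of polyhedral cones and polyhedrality of polars both follow from
Fourier-Motzkin elimination (`IsPolyhedralCone.image`, `isPolyhedralCone_polar`).
-/

namespace DisjunctiveStability

/-! ### Polyhedral cones -/

section PolyhedralCone

variable {E E' : Type*} [AddCommGroup E] [Module ℝ E] [AddCommGroup E'] [Module ℝ E']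

/-- A convex cone is polyhedral if it is the solution set of finitely many homogeneous linear
inequalities `f x ≤ 0`. -/
def IsPolyhedralCone (S : Set E) : Prop :=
  ∃ s : Set (E →ₗ[ℝ] ℝ), s.Finite ∧ S = {x | ∀ f ∈ s, f x ≤ 0}

lemma isPolyhedralCone_setOf_le {ι : Type*} [Finite ι] (f : ι → E →ₗ[ℝ] ℝ) :
    IsPolyhedralCone {x | ∀ i, f i x ≤ 0} :=
  ⟨Set.range f, Set.finite_range f, by ext; simp⟩

lemma IsPolyhedralCone.smul_mem {S : Set E} (hS : IsPolyhedralCone S) {x : E}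
    (hx : x ∈ S) {c : ℝ} (hc : 0 ≤ c) : c • x ∈ S := by
  obtain ⟨s, -, rfl⟩ := hS
  intro f hf
  rw [map_smul, smul_eq_mul]
  exact mul_nonpos_of_nonneg_of_nonpos hc (hx f hf)

lemma isPolyhedralCone_setOf_eq {ι : Type*} [Finite ι] (f : ι → E →ₗ[ℝ] ℝ) :
    IsPolyhedralCone {x | ∀ i, f i x = 0} :=
  ⟨Set.range f ∪ Set.range fun i => -f i, (Set.finite_range _).union (Set.finite_range _), by
    ext x
    simp only [Set.mem_ofPred_eq, Set.mem_union, Set.mem_range]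
    constructor
    · rintro h _ (⟨i, rfl⟩ | ⟨i, rfl⟩) <;> simp [h i]
    · intro h i
      have h1 := h (f i) (Or.inl ⟨i, rfl⟩)
      have h2 := h (-f i) (Or.inr ⟨i, rfl⟩)
      simp only [LinearMap.neg_apply] at h2
      linarith⟩

lemma IsPolyhedralCone.preimage {S : Set E'} (hS : IsPolyhedralCone S) (T : E →ₗ[ℝ] E') :
    IsPolyhedralCone (T ⁻¹' S) := by
  obtain ⟨s, hs, rfl⟩ := hS
  exact ⟨(fun f => f.comp T) '' s, hs.image _, by ext; simp⟩

lemma IsPolyhedralCone.iInter {ι : Type*} [Finite ι] {S : ι → Set E}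
    (hS : ∀ i, IsPolyhedralCone (S i)) : IsPolyhedralCone (⋂ i, S i) := by
  choose s hs h using hS
  refine ⟨⋃ i, s i, Set.finite_iUnion hs, ?_⟩
  ext x
  simp only [h, Set.mem_iInter, Set.mem_ofPred_eq, Set.mem_iUnion]
  exact ⟨fun H f ⟨i, hf⟩ => H i f hf, fun H i f hf => H f ⟨i, hf⟩⟩

lemma IsPolyhedralCone.inter {S S' : Set E} (hS : IsPolyhedralCone S)
    (hS' : IsPolyhedralCone S') : IsPolyhedralCone (S ∩ S') := by
  obtain ⟨s, hs, rfl⟩ := hS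
  obtain ⟨s', hs', rfl⟩ := hS'
  refine ⟨s ∪ s', hs.union hs', ?_⟩
  ext x
  simp only [Set.mem_inter_iff, Set.mem_ofPred_eq, Set.mem_union]
  exact ⟨fun H f hf => hf.elim (H.1 f) (H.2 f), fun H => ⟨fun f hf => H f (.inl hf),
    fun f hf => H f (.inr hf)⟩⟩

lemma exists_between_of_finite {s t : Set ℝ} (hs : s.Finite) (ht : t.Finite)
    (h : ∀ x ∈ s, ∀ y ∈ t, x ≤ y) : ∃ c, (∀ x ∈ s, x ≤ c) ∧ ∀ y ∈ t, c ≤ y := by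
  rcases s.eq_empty_or_nonempty with rfl | hs'
  · obtain ⟨c, hc⟩ := ht.bddBelow
    exact ⟨c, by simp, hc⟩
  rcases t.eq_empty_or_nonempty with rfl | ht'
  · obtain ⟨c, hc⟩ := hs.bddAbove
    exact ⟨c, hc, by simp⟩
  obtain ⟨c, hc⟩ := exists_between_of_forall_le hs' ht' h
  exact ⟨c, hc⟩

/-- One step of Fourier-Motzkin elimination: adding a line to a polyhedral cone leaves it
polyhedral. -/
lemma IsPolyhedralCone.add_line {S : Set E} (hS : IsPolyhedralCone S) (v : E) :
    IsPolyhedralCone {x | ∃ c : ℝ, x + c • v ∈ S} := by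
  obtain ⟨s, hs, rfl⟩ := hS
  refine ⟨{f ∈ s | f v = 0} ∪
    (fun fg : (E →ₗ[ℝ] ℝ) × (E →ₗ[ℝ] ℝ) => fg.1 v • fg.2 - fg.2 v • fg.1) ''
      ({f ∈ s | 0 < f v} ×ˢ {g ∈ s | g v < 0}),
    (hs.subset (Set.sep_subset _ _)).union
      (((hs.subset (Set.sep_subset _ _)).prod (hs.subset (Set.sep_subset _ _))).image _), ?_⟩
  ext x
  constructor
  · rintro ⟨c, hc⟩ f (hf | ⟨⟨f, g⟩, ⟨⟨hf, hfv⟩, hg, hgv⟩, rfl⟩)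
    · simpa [hf.2] using hc f hf.1
    · have h1 := hc f hf
      have h2 := hc g hg
      simp only [map_add, map_smul, smul_eq_mul] at h1 h2
      simp only [LinearMap.sub_apply, LinearMap.smul_apply, smul_eq_mul]
      dsimp only at hfv hgv
      nlinarith [mul_nonneg hfv.le (sub_nonneg.2 h2),
        mul_nonneg (neg_nonneg.2 hgv.le) (sub_nonneg.2 h1)]
  · intro h
    -- The coefficient `c` has to lie above all bounds from functionals negative at `v` and below
    -- all bounds from functionals positive at `v`.
    obtain ⟨c, hc1, hc2⟩ := exists_between_of_finite
      (s := (fun g : E →ₗ[ℝ] ℝ => -g x / g v) '' {g ∈ s | g v < 0})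
      (t := (fun f : E →ₗ[ℝ] ℝ => -f x / f v) '' {f ∈ s | 0 < f v})
      ((hs.subset (Set.sep_subset _ _)).image _) ((hs.subset (Set.sep_subset _ _)).image _) (by
        rintro _ ⟨g, hg, rfl⟩ _ ⟨f, hf, rfl⟩
        have := h _ (Or.inr ⟨(f, g), ⟨hf, hg⟩, rfl⟩)
        simp only [LinearMap.sub_apply, LinearMap.smul_apply, smul_eq_mul] at this
        have hfv := hf.2
        have hgv := hg.2
        change -g x / g v ≤ -f x / f v
        rw [← neg_div_neg_eq, neg_neg, div_le_div_iff₀ (neg_pos.2 hgv) hfv]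
        linarith)
    refine ⟨c, fun f hf => ?_⟩
    simp only [map_add, map_smul, smul_eq_mul]
    rcases lt_trichotomy (f v) 0 with hv | hv | hv
    · have := hc1 _ ⟨f, ⟨hf, hv⟩, rfl⟩
      simp only [div_le_iff_of_neg hv] at this
      linarith
    · simpa [hv] using h f (.inl ⟨hf, hv⟩)
    · have := hc2 _ ⟨f, ⟨hf, hv⟩, rfl⟩
      simp only [le_div_iff₀ hv] at this
      linarith

lemma IsPolyhedralCone.add_span_range {S : Set E} (hS : IsPolyhedralCone S) {d : ℕ}
    (v : Fin d → E) : IsPolyhedralCone {x | ∃ c : Fin d → ℝ, x + ∑ i, c i • v i ∈ S} := by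
  induction d with
  | zero => simpa using hS
  | succ d ih =>
    convert (ih fun i => v i.succ).add_line (v 0) using 1
    ext x
    simp only [Set.mem_ofPred_eq, Fin.sum_univ_succ, ← add_assoc]
    exact ⟨fun ⟨c, hc⟩ => ⟨c 0, fun i => c i.succ, hc⟩,
      fun ⟨c₀, c, hc⟩ => ⟨Fin.cons c₀ c, by simpa using hc⟩⟩

/-- Linear images of polyhedral cones are polyhedral: the image is obtained from the graph
by eliminating the variables of the domain. -/
lemma IsPolyhedralCone.image [FiniteDimensional ℝ E] [FiniteDimensional ℝ E'] {S : Set E}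
    (hS : IsPolyhedralCone S) (T : E →ₗ[ℝ] E') : IsPolyhedralCone (T '' S) := by
  let bE := Module.finBasis ℝ E
  let bE' := Module.finBasis ℝ E'
  have hgraph : IsPolyhedralCone {z : E × E' | z.1 ∈ S ∧ T z.1 = z.2} := by
    convert (hS.preimage (LinearMap.fst ℝ E E')).inter (isPolyhedralCone_setOf_eq fun i =>
      (bE'.coord i).comp (T.comp (LinearMap.fst ℝ E E') - LinearMap.snd ℝ E E')) using 1
    ext z
    refine and_congr Iff.rfl ?_
    simp only [Set.mem_ofPred_eq, LinearMap.comp_apply, bE'.forall_coord_eq_zero_iff,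
      LinearMap.sub_apply, LinearMap.fst_apply, LinearMap.snd_apply, sub_eq_zero]
  convert (hgraph.add_span_range fun i => (bE i, (0 : E'))).preimage (LinearMap.inr ℝ E E')
    using 1
  ext y
  have hsum : ∀ c : Fin (Module.finrank ℝ E) → ℝ,
      (LinearMap.inr ℝ E E') y + ∑ i, c i • (bE i, (0 : E')) = (∑ i, c i • bE i, y) := by
    intro c
    ext <;> simp [Prod.fst_sum, Prod.snd_sum]
  simp only [Set.mem_image, Set.mem_preimage, Set.mem_ofPred_eq, hsum]
  constructor
  · rintro ⟨x, hx, rfl⟩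
    exact ⟨bE.repr x, by simpa [bE.sum_repr] using hx⟩
  · rintro ⟨c, hc, hT⟩
    exact ⟨_, hc, hT⟩

end PolyhedralCone

section Topological

variable {E : Type*} [NormedAddCommGroup E] [InnerProductSpace ℝ E] [FiniteDimensional ℝ E]

lemma IsPolyhedralCone.isClosed {S : Set E} (hS : IsPolyhedralCone S) : IsClosed S := by
  obtain ⟨s, hs, rfl⟩ := hS
  have : {x : E | ∀ f ∈ s, f x ≤ 0} = ⋂ f ∈ s, {x | f x ≤ 0} := by ext; simp
  rw [this]
  exact isClosed_biInter fun f _ =>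
    isClosed_le f.continuous_of_finiteDimensional continuous_const

/-- The polar of a polyhedral cone is polyhedral. By Farkas' lemma it is the image
of the nonnegative orthant under `c ↦ ∑ j, c j • a j`. -/
lemma isPolyhedralCone_polar {ι : Type*} [Finite ι] (a : ι → E) :
    IsPolyhedralCone {ξ : E | ∀ h, (∀ j, inner ℝ (a j) h ≤ 0) → inner ℝ ξ h ≤ 0} := by
  cases nonempty_fintype ι
  have horth : IsPolyhedralCone {c : ι → ℝ | ∀ j, (-LinearMap.proj j : (ι → ℝ) →ₗ[ℝ] ℝ) c ≤ 0} :=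
    isPolyhedralCone_setOf_le _
  convert horth.image (Fintype.linearCombination ℝ a) using 1
  obtain ⟨s, -, hs⟩ := horth.image (Fintype.linearCombination ℝ a)
  ext ξ
  constructor
  · intro hξ
    rw [hs]
    intro f hf
    have hrep : ∀ x,
        f x = inner ℝ ((InnerProductSpace.toDual ℝ E).symm f.toContinuousLinearMap) x := by
      intro x
      simp
    rw [hrep, real_inner_comm]
    refine hξ _ fun j => ?_
    rw [real_inner_comm, ← hrep]
    have hj : a j ∈ (Fintype.linearCombination ℝ a) ''
        {c : ι → ℝ | ∀ j, (-LinearMap.proj j : (ι → ℝ) →ₗ[ℝ] ℝ) c ≤ 0} := by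
      classical
      refine ⟨Pi.single j 1, fun i => ?_, by simp⟩
      simpa using (Pi.single_nonneg.2 zero_le_one : (0 : ι → ℝ) ≤ Pi.single j 1) i
    rw [hs] at hj
    exact hj f hf
  · rintro ⟨c, hc, rfl⟩ h hh
    simp only [Fintype.linearCombination_apply, sum_inner, inner_smul_left]
    refine Finset.sum_nonpos fun j _ => mul_nonpos_of_nonneg_of_nonpos ?_ (hh j)
    simpa using hc j

end Topological

/-! ### Tangents and normals of finite unions of polyhedra -/

section Cones

variable {E : Type*} [NormedAddCommGroup E] [InnerProductSpace ℝ E]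

lemma contingentCone_mono {x : E} {Γ Γ' : Set E} (h : Γ ⊆ Γ') :
    contingentCone x Γ ⊆ contingentCone x Γ' := by
  rintro u ⟨hx, t, w, ht, ht0, hw, hmem⟩
  exact ⟨h hx, t, w, ht, ht0, hw, fun k => h (hmem k)⟩

lemma mem_contingentCone_of_forall_pos {x u : E} {Γ : Set E} (hx : x ∈ Γ)
    (h : ∀ ε > 0, ∃ (t : ℝ) (w : E), 0 < t ∧ t < ε ∧ ‖w - u‖ < ε ∧ x + t • w ∈ Γ) :
    u ∈ contingentCone x Γ := by
  choose t w ht htε hw hmem using fun k : ℕ => h _ (Nat.one_div_pos_of_nat (α := ℝ) (n := k))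
  exact ⟨hx, t, w, ht, squeeze_zero (fun k => (ht k).le) (fun k => (htε k).le)
    tendsto_one_div_add_atTop_nhds_zero_nat, tendsto_iff_norm_sub_tendsto_zero.2 <|
    squeeze_zero (fun k => norm_nonneg _) (fun k => (hw k).le)
      tendsto_one_div_add_atTop_nhds_zero_nat, hmem⟩

lemma mem_directionalNormalCone_of_forall_pos {x u ξ : E} {Γ : Set E} (hx : x ∈ Γ)
    (h : ∀ ε > 0, ∃ (t : ℝ) (w ζ : E), 0 < t ∧ t < ε ∧ ‖w - u‖ < ε ∧ ‖ζ - ξ‖ < ε ∧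
      ζ ∈ regularNormalCone (x + t • w) Γ) :
    ξ ∈ directionalNormalCone x Γ u := by
  choose t w ζ ht htε hw hζ hmem using
    fun k : ℕ => h _ (Nat.one_div_pos_of_nat (α := ℝ) (n := k))
  exact ⟨hx, t, w, ζ, ht, squeeze_zero (fun k => (ht k).le) (fun k => (htε k).le)
    tendsto_one_div_add_atTop_nhds_zero_nat, tendsto_iff_norm_sub_tendsto_zero.2 <|
    squeeze_zero (fun k => norm_nonneg _) (fun k => (hw k).le)
      tendsto_one_div_add_atTop_nhds_zero_nat, tendsto_iff_norm_sub_tendsto_zero.2 <|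
    squeeze_zero (fun k => norm_nonneg _) (fun k => (hζ k).le)
      tendsto_one_div_add_atTop_nhds_zero_nat, hmem⟩

/-- A feasible direction of `Γ` at `x` is tangent to `Γ` at `x`. -/
lemma mem_contingentCone_of_eventually {x u : E} {Γ : Set E} (hx : x ∈ Γ)
    (h : ∀ᶠ t : ℝ in 𝓝[>] 0, x + t • u ∈ Γ) : u ∈ contingentCone x Γ := by
  refine mem_contingentCone_of_forall_pos hx fun ε hε => ?_
  obtain ⟨t, hmem, ht⟩ := (h.and (Ioo_mem_nhdsGT hε)).exists
  exact ⟨t, u, ht.1, ht.2, by simpa using hε, hmem⟩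

/-- A regular normal makes a nonpositive inner product with every feasible direction. -/
lemma inner_nonpos_of_mem_regularNormalCone {x ξ u : E} {Γ : Set E}
    (hξ : ξ ∈ regularNormalCone x Γ) (h : ∀ᶠ t : ℝ in 𝓝[>] 0, x + t • u ∈ Γ) :
    inner ℝ ξ u ≤ 0 := by
  refine le_of_forall_pos_le_add fun ε hε => ?_
  have hδ : 0 < ε / (‖u‖ + 1) := by positivity
  have hlim : Tendsto (fun t : ℝ => x + t • u) (𝓝[>] 0) (𝓝[Γ] x) := by
    refine tendsto_nhdsWithin_iff.2 ⟨?_, h⟩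
    have : Continuous fun t : ℝ => x + t • u := by fun_prop
    simpa using (this.tendsto 0).mono_left nhdsWithin_le_nhds
  obtain ⟨t, ht, ht0⟩ := ((hlim.eventually (hξ.2 _ hδ)).and self_mem_nhdsWithin).exists
  have ht0 : 0 < t := ht0
  simp only [add_sub_cancel_left, inner_smul_right, norm_smul, Real.norm_eq_abs,
    abs_of_pos ht0] at ht
  have h1 : t * inner ℝ ξ u ≤ t * (ε / (‖u‖ + 1) * ‖u‖) := by linarith
  have h2 := le_of_mul_le_mul_left h1 ht0
  have h3 : ε / (‖u‖ + 1) * ‖u‖ ≤ ε := by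
    rw [div_mul_eq_mul_div, div_le_iff₀ (by positivity)]
    nlinarith
  linarith

/-- A direction along which the active inequalities do not increase is feasible. -/
lemma eventually_forall_le {ι : Type*} [Finite ι] {f : ι → E →ₗ[ℝ] ℝ} {b : ι → ℝ} {x u : E}
    (hx : ∀ j, f j x ≤ b j) (hu : ∀ j, f j x = b j → f j u ≤ 0) :
    ∀ᶠ t : ℝ in 𝓝[>] 0, ∀ j, f j (x + t • u) ≤ b j := by
  refine eventually_all.2 fun j => ?_
  rcases (hx j).eq_or_lt with hj | hj
  · filter_upwards [self_mem_nhdsWithin] with t ht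
    have ht : 0 < t := ht
    have := hu j hj
    simp only [map_add, map_smul, smul_eq_mul]
    nlinarith
  · have hc : Continuous fun t : ℝ => f j (x + t • u) := by
      simp only [map_add, map_smul]
      fun_prop
    have := (hc.tendsto 0).eventually_lt_const (u := b j) (by simpa using hj)
    exact (this.filter_mono nhdsWithin_le_nhds).mono fun t ht => ht.le

lemma isClosed_polyhedron {r : ℕ} (a : Fin r → E) (b : Fin r → ℝ) : IsClosed (polyhedron a b) := by
  have : polyhedron a b = ⋂ j, {y | inner ℝ (a j) y ≤ b j} := by ext; simp [polyhedron]
  rw [this]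
  exact isClosed_iInter fun j => isClosed_le (by fun_prop) continuous_const

/-- The tangent cone of a polyhedral set at `x` contains a polyhedral cone (in fact it is one)
that in turn contains the translate of the set by `-x`. -/
lemma exists_isPolyhedralCone_subset_contingentCone {ι : Type*} [Finite ι] {f : ι → E →ₗ[ℝ] ℝ}
    {b : ι → ℝ} {x : E} (hx : ∀ j, f j x ≤ b j) :
    ∃ K : Set E, IsPolyhedralCone K ∧ (∀ z, (∀ j, f j z ≤ b j) → z - x ∈ K) ∧
      K ⊆ contingentCone x {z | ∀ j, f j z ≤ b j} := by
  refine ⟨{u | ∀ j : {j // f j x = b j}, f j u ≤ 0}, isPolyhedralCone_setOf_le _, ?_, ?_⟩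
  · rintro z hz ⟨j, hj⟩
    simpa [hj] using hz j
  · intro u hu
    exact mem_contingentCone_of_eventually hx (eventually_forall_le hx fun j hj => hu ⟨j, hj⟩)

lemma eventually_mem_polyhedron_imp {ι : Type*} [Finite ι] {r : ι → ℕ}
    {a : (i : ι) → Fin (r i) → E} {b : (i : ι) → Fin (r i) → ℝ} (x : E) :
    ∀ᶠ z in 𝓝 x, ∀ i, z ∈ polyhedron (a i) (b i) → x ∈ polyhedron (a i) (b i) := by
  refine eventually_all.2 fun i => ?_
  by_cases hx : x ∈ polyhedron (a i) (b i)
  · exact Eventually.of_forall fun _ _ => hx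
  · filter_upwards [(isClosed_polyhedron (a i) (b i)).isOpen_compl.mem_nhds hx] with z hz hz'
    exact absurd hz' hz

lemma IsPolyhedralCone.exists_subset_contingentCone {S : Set E} (hS : IsPolyhedralCone S) {x : E}
    (hx : x ∈ S) : ∃ K : Set E, IsPolyhedralCone K ∧ (∀ z ∈ S, z - x ∈ K) ∧
      K ⊆ contingentCone x S := by
  obtain ⟨s, hs, rfl⟩ := hS
  have := hs.to_subtype
  obtain ⟨K, hK, h1, h2⟩ := exists_isPolyhedralCone_subset_contingentCone
    (f := fun f : s => (f : E →ₗ[ℝ] ℝ)) (b := fun _ => 0) (x := x) (fun f => hx f f.2)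
  exact ⟨K, hK, fun z hz => h1 z fun f => hz f f.2, by simpa using h2⟩

lemma polyhedron_exists_subset_contingentCone {r : ℕ} {a : Fin r → E} {b : Fin r → ℝ} {x : E}
    (hx : x ∈ polyhedron a b) : ∃ K : Set E, IsPolyhedralCone K ∧
      (∀ z ∈ polyhedron a b, z - x ∈ K) ∧ K ⊆ contingentCone x (polyhedron a b) :=
  exists_isPolyhedralCone_subset_contingentCone (f := fun j => (innerₛₗ ℝ (a j))) hx

variable {ι : Type*} [Finite ι] {r : ι → ℕ} {a : (i : ι) → Fin (r i) → E}
  {b : (i : ι) → Fin (r i) → ℝ}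

/-- The regular normal cone of a finite union of polyhedra is the polar of the union of the
cones cut out by the constraints active in the pieces containing `z`. -/
lemma regularNormalCone_iUnion_polyhedron {z : E} (hz : z ∈ ⋃ i, polyhedron (a i) (b i)) :
    regularNormalCone z (⋃ i, polyhedron (a i) (b i)) =
      {ξ | ∀ i, z ∈ polyhedron (a i) (b i) → ∀ h,
        (∀ j, inner ℝ (a i j) z = b i j → inner ℝ (a i j) h ≤ 0) → inner ℝ ξ h ≤ 0} := by
  ext ξ
  constructor
  · intro hξ i hi h hh
    refine inner_nonpos_of_mem_regularNormalCone hξ ?_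
    filter_upwards [eventually_forall_le (f := fun j => (innerₛₗ ℝ (a i j))) hi hh] with t ht
    exact Set.mem_iUnion.2 ⟨i, ht⟩
  · intro hξ
    refine ⟨hz, fun ε hε => ?_⟩
    filter_upwards [(eventually_mem_polyhedron_imp (a := a) (b := b) z).filter_mono
      nhdsWithin_le_nhds, self_mem_nhdsWithin] with z' hz' hmem
    obtain ⟨i, hi⟩ := Set.mem_iUnion.1 hmem
    refine (hξ i (hz' i hi) (z' - z) fun j hj => ?_).trans (by positivity)
    rw [inner_sub_right, hj]
    linarith [hi j]

/-- The regular normal cones of a finite union of polyhedra form a finite family, since they are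
determined by the pieces containing the point and the constraints active there. -/
lemma finite_regularNormalCones :
    {C | ∃ z ∈ ⋃ i, polyhedron (a i) (b i),
      C = regularNormalCone z (⋃ i, polyhedron (a i) (b i))}.Finite := by
  refine (Set.finite_range fun s : Set ι × ((i : ι) → Set (Fin (r i))) =>
    {ξ : E | ∀ i ∈ s.1, ∀ h, (∀ j ∈ s.2 i, inner ℝ (a i j) h ≤ 0) → inner ℝ ξ h ≤ 0}).subset ?_
  rintro _ ⟨z, hz, rfl⟩
  exact ⟨⟨{i | z ∈ polyhedron (a i) (b i)}, fun i => {j | inner ℝ (a i j) z = b i j}⟩,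
    (regularNormalCone_iUnion_polyhedron hz).symm⟩

/-- Close to `x`, each polyhedron containing `x` coincides with a cone with apex `x`, so regular
normals at `z` are orthogonal to `z - x`. -/
lemma eventually_inner_regularNormalCone_eq_zero (x : E) :
    ∀ᶠ z in 𝓝 x, ∀ ζ ∈ regularNormalCone z (⋃ i, polyhedron (a i) (b i)),
      ∀ i, z ∈ polyhedron (a i) (b i) → inner ℝ ζ (z - x) = 0 := by
  have hact : ∀ᶠ z in 𝓝 x, ∀ i, ∀ j, inner ℝ (a i j) x < b i j → inner ℝ (a i j) z < b i j := by
    refine eventually_all.2 fun i => eventually_all.2 fun j => ?_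
    by_cases hj : inner ℝ (a i j) x < b i j
    · have hc : Continuous fun z : E => (inner ℝ (a i j) z : ℝ) := by fun_prop
      filter_upwards [(hc.tendsto x).eventually_lt_const hj] with z hz _ using hz
    · exact Eventually.of_forall fun _ h => absurd h hj
  filter_upwards [hact, eventually_mem_polyhedron_imp (a := a) (b := b) x] with z hz hz' ζ hζ i hi
  have hx := hz' i hi
  rw [regularNormalCone_iUnion_polyhedron hζ.1] at hζ
  refine le_antisymm (hζ i hi _ fun j hj => ?_) ?_
  · have : inner ℝ (a i j) x = b i j := by
      by_contra hne
      exact (hz i j (lt_of_le_of_ne (hx j) hne)).ne hj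
    rw [inner_sub_right, hj, this, sub_self]
  · have := hζ i hi (x - z) fun j hj => by
      rw [inner_sub_right, hj]
      linarith [hx j]
    rw [← neg_sub, inner_neg_right] at this
    linarith

lemma isPolyhedralCone_regularNormalCone [FiniteDimensional ℝ E] {z : E}
    (hz : z ∈ ⋃ i, polyhedron (a i) (b i)) :
    IsPolyhedralCone (regularNormalCone z (⋃ i, polyhedron (a i) (b i))) := by
  rw [regularNormalCone_iUnion_polyhedron hz]
  convert IsPolyhedralCone.iInter fun i : {i // z ∈ polyhedron (a i) (b i)} =>
    isPolyhedralCone_polar fun j : {j // inner ℝ (a i j) z = b i j} => a i j using 1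
  ext ξ
  simp

end Cones

/-! ### Multipliers for regular normals under metric regularity -/

section Multipliers

variable {X Y : Type*} [NormedAddCommGroup X] [InnerProductSpace ℝ X]
  [NormedAddCommGroup Y] [InnerProductSpace ℝ Y]

/-- If `g` decreases near `x` at most at rate `c`, its gradient at `x` has norm at most `c`. -/
lemma norm_le_of_forall_le_add {g : X → ℝ} {v x : X} {c : ℝ}
    (hg : HasFDerivAt g (innerSL ℝ v) x) (hc : 0 ≤ c)
    (h : ∀ᶠ x' in 𝓝 x, g x ≤ g x' + c * ‖x' - x‖) : ‖v‖ ≤ c := by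
  rcases eq_or_ne v 0 with rfl | hv
  · simpa using hc
  have hv' : 0 < ‖v‖ := norm_pos_iff.2 hv
  refine le_of_forall_pos_le_add fun ε hε => ?_
  have hlim : Tendsto (fun s : ℝ => x - s • v) (𝓝[>] 0) (𝓝 x) := by
    have : Continuous fun s : ℝ => x - s • v := by fun_prop
    simpa using (this.tendsto 0).mono_left nhdsWithin_le_nhds
  obtain ⟨s, ⟨h1, h2⟩, hs⟩ := ((hlim.eventually (h.and (hg.isLittleO.def hε))).and
    self_mem_nhdsWithin).exists
  have hs : 0 < s := hs
  have h3 : ‖x - s • v - x‖ = s * ‖v‖ := by simp [norm_smul, abs_of_pos hs]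
  rw [h3] at h1 h2
  have h4 := le_of_abs_le h2
  simp only [innerSL_apply_apply, sub_sub_cancel_left, inner_neg_right, inner_smul_right,
    real_inner_self_eq_norm_sq] at h4
  have h5 : s * ‖v‖ * ‖v‖ ≤ s * ‖v‖ * (c + ε) := by nlinarith
  exact le_of_mul_le_mul_left h5 (by positivity)

/-- The residual at a closest point of `P` is a regular normal. -/
lemma smul_sub_mem_regularNormalCone {P : Set Y} {y z : Y} {c : ℝ} (hc : 0 ≤ c) (hz : z ∈ P)
    (h : ∀ᶠ z' in 𝓝[P] z, ‖y - z‖ ^ 2 ≤ ‖y - z'‖ ^ 2) :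
    (2 * c) • (y - z) ∈ regularNormalCone z P := by
  refine ⟨hz, fun ε hε => ?_⟩
  have hlim : Tendsto (fun z' : Y => c * ‖z' - z‖) (𝓝[P] z) (𝓝 0) := by
    have : Continuous fun z' : Y => c * ‖z' - z‖ := by fun_prop
    simpa using (this.tendsto z).mono_left nhdsWithin_le_nhds
  filter_upwards [h, hlim.eventually_le_const hε] with z' h1 h2
  have h3 : ‖y - z'‖ ^ 2 = ‖y - z‖ ^ 2 - 2 * inner ℝ (y - z) (z' - z) + ‖z' - z‖ ^ 2 := by
    rw [← norm_sub_sq_real]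
    congr 2
    abel
  rw [real_inner_smul_left]
  have h4 := mul_le_mul_of_nonneg_left
    (show 2 * inner ℝ (y - z) (z' - z) ≤ ‖z' - z‖ ^ 2 by linarith) hc
  nlinarith [norm_nonneg (z' - z)]

variable [FiniteDimensional ℝ X] [FiniteDimensional ℝ Y]

/-- Metric regularity of `x' ↦ G x' - P` bounds the regular normals `ζ` to `P` by the images
`(DG)ᵀ ζ`: solve `G x'' - P ∋ y` for `y` displaced by a small multiple of `-ζ`. -/
lemma norm_le_of_metricallyRegularAround {G : X → Y} {P : Set Y} {κ : ℝ} {x : X}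
    (h : MetricallyRegularAround (fun x' => {y | ∃ z ∈ P, y = G x' - z}) κ x 0)
    (hG : ∀ᶠ x' in 𝓝 x, DifferentiableAt ℝ G x') :
    ∀ᶠ p : X × Y in 𝓝 (x, G x), ∀ ζ ∈ regularNormalCone p.2 P,
      ‖ζ‖ ≤ κ * ‖ContinuousLinearMap.adjoint (fderiv ℝ G p.1) ζ‖ := by
  obtain ⟨hκ, -, U, hU, V, hV, hreg⟩ := h
  have hGx : ContinuousAt G x := hG.self_of_nhds.continuousAt
  have hVev : ∀ᶠ p : X × Y in 𝓝 (x, G x), ∀ᶠ y in 𝓝 (G p.1 - p.2), y ∈ V := by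
    have hlim : Tendsto (fun p : X × Y => G p.1 - p.2) (𝓝 (x, G x)) (𝓝 0) := by
      have : ContinuousAt (fun p : X × Y => G p.1 - p.2) (x, G x) :=
        (hGx.comp_of_eq continuousAt_fst rfl).sub continuousAt_snd
      simpa using this.tendsto
    exact hlim.eventually (eventually_eventually_nhds.2 hV)
  rw [nhds_prod_eq] at hVev ⊢
  filter_upwards [hVev, (eventually_mem_set.2 hU).prod_inl (𝓝 (G x)), hG.prod_inl (𝓝 (G x))]
    with ⟨x', z⟩ hV' hU' hG' ζ hζ
  dsimp only at hV' hU' hG' hζ ⊢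
  set A := fderiv ℝ G x'
  set B := ContinuousLinearMap.adjoint A ζ with hB
  rcases eq_or_ne ζ 0 with rfl | hζ0
  · simp only [norm_zero]; positivity
  have hζpos : 0 < ‖ζ‖ := norm_pos_iff.2 hζ0
  -- `C` collects the coefficients of the error terms below.
  set C := ‖B‖ + ‖ζ‖ * (κ + 1) + (1 + (‖A‖ + 1) * (κ + 1)) with hC
  have hCpos : 0 < C := by positivity
  suffices H : ∀ ε, 0 < ε → ε ≤ 1 → ‖ζ‖ ≤ κ * ‖B‖ + ε * C by
    refine le_of_forall_pos_le_add fun δ hδ => ?_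
    refine (H (min 1 (δ / C)) (by positivity) (min_le_left _ _)).trans ?_
    have := mul_le_mul_of_nonneg_right (min_le_right 1 (δ / C)) hCpos.le
    rw [div_mul_cancel₀ _ hCpos.ne'] at this
    linarith
  intro ε hε hε1
  -- the radius `ρ` on which both the normal inequality and the linearization hold up to `ε`
  obtain ⟨ρ₁, hρ₁, hn⟩ := Metric.eventually_nhds_iff.1 (eventually_nhdsWithin_iff.1 (hζ.2 ε hε))
  obtain ⟨ρ₂, hρ₂, hd⟩ := Metric.eventually_nhds_iff.1 (hG'.hasFDerivAt.isLittleO.def hε)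
  have hsV : ∀ᶠ s : ℝ in 𝓝[>] 0, G x' - z - s • ζ ∈ V := by
    have hc : Continuous fun s : ℝ => G x' - z - s • ζ := by fun_prop
    have := hc.tendsto 0
    simp only [zero_smul, sub_zero] at this
    exact (this.eventually hV').filter_mono nhdsWithin_le_nhds
  have hsmall : ∀ {ρ : ℝ} (c : ℝ), 0 < ρ → ∀ᶠ s : ℝ in 𝓝[>] 0, c * s < ρ := by
    intro ρ c hρ
    have hc : Continuous fun s : ℝ => c * s := by fun_prop
    have := hc.tendsto 0
    rw [mul_zero] at this
    exact (this.eventually_lt_const hρ).filter_mono nhdsWithin_le_nhds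
  obtain ⟨s, ⟨⟨hsV, hs₁⟩, hs₂⟩, hs0⟩ := (((hsV.and
    (hsmall ((1 + (‖A‖ + 1) * (κ + 1)) * ‖ζ‖) hρ₁)).and (hsmall ((κ + 1) * ‖ζ‖) hρ₂)).and
    self_mem_nhdsWithin).exists
  have hs0 : 0 < s := hs0
  -- solve the displaced system
  have hle := hreg x' hU' _ hsV
  have hm : G x' - z ∈ {y | ∃ z ∈ P, y = G x' - z} := ⟨z, hζ.1, rfl⟩
  have hdist : Metric.infEDist (G x' - z - s • ζ) {y | ∃ z ∈ P, y = G x' - z} ≤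
      ENNReal.ofReal (s * ‖ζ‖) := by
    refine (Metric.infEDist_le_edist_of_mem hm).trans_eq ?_
    rw [edist_dist, dist_eq_norm]
    simp [norm_smul, abs_of_pos hs0]
  have hlt : Metric.infEDist x' {x'' | G x' - z - s • ζ ∈ {y | ∃ z ∈ P, y = G x'' - z}} <
      ENNReal.ofReal ((κ + ε) * (s * ‖ζ‖)) := by
    refine (hle.trans (mul_le_mul_right hdist _)).trans_lt ?_
    rw [← ENNReal.ofReal_mul hκ.le, ENNReal.ofReal_lt_ofReal_iff (by positivity)]
    nlinarith [mul_pos hs0 hζpos, mul_pos hε (mul_pos hs0 hζpos)]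
  obtain ⟨x'', ⟨z', hz', hzeq⟩, hx''⟩ := Metric.infEDist_lt_iff.1 hlt
  rw [edist_dist, ENNReal.ofReal_lt_ofReal_iff (by positivity), dist_comm, dist_eq_norm] at hx''
  have hs' : 0 < s * ‖ζ‖ := by positivity
  have hκε : (κ + ε) * (s * ‖ζ‖) ≤ (κ + 1) * (s * ‖ζ‖) := by gcongr
  have hzz : z' - z = s • ζ + (G x'' - G x') := by
    have : z' = G x'' - (G x' - z - s • ζ) := by rw [hzeq]; abel
    rw [this]; abel
  have hlin : ‖G x'' - G x' - A (x'' - x')‖ ≤ ε * ‖x'' - x'‖ :=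
    hd (by rw [dist_eq_norm]; linarith)
  have hGd : ‖G x'' - G x'‖ ≤ (‖A‖ + 1) * ((κ + 1) * (s * ‖ζ‖)) := by
    calc ‖G x'' - G x'‖ = ‖A (x'' - x') + (G x'' - G x' - A (x'' - x'))‖ := by congr 1; abel
      _ ≤ ‖A‖ * ‖x'' - x'‖ + ε * ‖x'' - x'‖ := (norm_add_le _ _).trans
          (add_le_add (A.le_opNorm _) hlin)
      _ ≤ (‖A‖ + 1) * ‖x'' - x'‖ := by nlinarith [norm_nonneg (x'' - x')]
      _ ≤ _ := by gcongr; linarith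
  have hzn : ‖z' - z‖ ≤ (1 + (‖A‖ + 1) * (κ + 1)) * (s * ‖ζ‖) := by
    rw [hzz]
    refine (norm_add_le _ _).trans ?_
    rw [norm_smul, Real.norm_eq_abs, abs_of_pos hs0]
    linarith
  have hnorm := hn (y := z') (by rw [dist_eq_norm]; linarith) hz'
  have hinner : inner ℝ ζ (z' - z) = s * ‖ζ‖ * ‖ζ‖ + inner ℝ B (x'' - x') +
      inner ℝ ζ (G x'' - G x' - A (x'' - x')) := by
    rw [hzz, hB, ContinuousLinearMap.adjoint_inner_left, inner_add_right, inner_smul_right,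
      real_inner_self_eq_norm_sq, inner_sub_right _ (G x'' - G x')]
    ring
  have h1 : -(‖B‖ * ((κ + ε) * (s * ‖ζ‖))) ≤ inner ℝ B (x'' - x') := by
    have := neg_le_of_abs_le (abs_real_inner_le_norm B (x'' - x'))
    have : ‖B‖ * ‖x'' - x'‖ ≤ ‖B‖ * ((κ + ε) * (s * ‖ζ‖)) := by gcongr
    linarith
  have h2 : -(‖ζ‖ * (ε * ((κ + 1) * (s * ‖ζ‖)))) ≤
      inner ℝ ζ (G x'' - G x' - A (x'' - x')) := by
    have := neg_le_of_abs_le (abs_real_inner_le_norm ζ (G x'' - G x' - A (x'' - x')))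
    have : ‖ζ‖ * ‖G x'' - G x' - A (x'' - x')‖ ≤ ‖ζ‖ * (ε * ((κ + 1) * (s * ‖ζ‖))) := by
      gcongr
      refine hlin.trans ?_
      gcongr
      linarith
    linarith
  have h3 : ε * ‖z' - z‖ ≤ ε * ((1 + (‖A‖ + 1) * (κ + 1)) * (s * ‖ζ‖)) := by gcongr
  have h4 : (s * ‖ζ‖) * ‖ζ‖ ≤ (s * ‖ζ‖) * (κ * ‖B‖ + ε * C) := by
    rw [hC]
    linarith
  exact le_of_mul_le_mul_left h4 hs'

/-- Fuzzy chain rule for the regular normals of a preimage `G ⁻¹' P`: minimize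
`-⟪ξ, x' - x⟫ + 2 ε ‖x' - x‖ + (j + 1) ‖G x' - z‖²` over `x'` near `x` and `z ∈ P` near `G x`. The
minimizers tend to `(x, G x)` as `j → ∞`, and the penalty term provides the multiplier. -/
lemma exists_approx_multiplier {G : X → Y} {P : Set Y} (hP : IsClosed P) {x ξ : X}
    (hG : ∀ᶠ x' in 𝓝 x, DifferentiableAt ℝ G x')
    (hξ : ξ ∈ regularNormalCone x {x' | G x' ∈ P}) {ε : ℝ} (hε : 0 < ε) :
    ∃ᶠ p : X × Y in 𝓝 (x, G x), ∃ ζ ∈ regularNormalCone p.2 P,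
      ‖ContinuousLinearMap.adjoint (fderiv ℝ G p.1) ζ - ξ‖ ≤ 2 * ε := by
  obtain ⟨δ, hδ, hball⟩ := Metric.nhds_basis_closedBall.mem_iff.1
    (inter_mem (eventually_mem_set.1 hG) (eventually_nhdsWithin_iff.1 (hξ.2 ε hε)))
  have hcont : ContinuousOn G (Metric.closedBall x δ) := fun x' hx' =>
    (show DifferentiableAt ℝ G x' from (hball hx').1).continuousAt.continuousWithinAt
  set K := Metric.closedBall x δ ×ˢ (P ∩ Metric.closedBall (G x) 1) with hK
  have hKc : IsCompact K := (isCompact_closedBall _ _).prod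
    ((isCompact_closedBall _ _).inter_left hP)
  have hxK : (x, G x) ∈ K := ⟨Metric.mem_closedBall_self hδ.le, hξ.1,
    Metric.mem_closedBall_self zero_le_one⟩
  let φ : ℕ → X × Y → ℝ := fun j p =>
    -inner ℝ ξ (p.1 - x) + 2 * ε * ‖p.1 - x‖ + (j + 1) * ‖G p.1 - p.2‖ ^ 2
  have hGK : ContinuousOn (fun p : X × Y => G p.1) K :=
    hcont.comp continuousOn_fst fun p hp => hp.1
  have hφc : ∀ j, ContinuousOn (φ j) K := fun j => by
    refine ContinuousOn.add (Continuous.continuousOn (by fun_prop)) ?_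
    exact continuousOn_const.mul ((hGK.sub continuousOn_snd).norm.pow 2)
  choose p hpK hp using fun j => hKc.exists_isMinOn ⟨_, hxK⟩ (hφc j)
  obtain ⟨⟨x', z⟩, hlimK, ψ, hψ, hlim⟩ := hKc.tendsto_subseq hpK
  have hle0 : ∀ j, φ j (p j) ≤ 0 := fun j => by
    simpa [φ] using hp j hxK
  have hlim1 : Tendsto (fun k => (p (ψ k)).1) atTop (𝓝 x') := (continuous_fst.tendsto _).comp hlim
  have hGlim : Tendsto (fun k => ‖G (p (ψ k)).1 - (p (ψ k)).2‖ ^ 2) atTop (𝓝 (‖G x' - z‖ ^ 2)) := by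
    have h1 := hGK (x', z) hlimK
    have h2 : Tendsto (p ∘ ψ) atTop (𝓝[K] (x', z)) :=
      tendsto_nhdsWithin_iff.2 ⟨hlim, Eventually.of_forall fun k => hpK _⟩
    exact (((h1.tendsto.comp h2).sub ((continuous_snd.tendsto _).comp hlim)).norm).pow 2
  -- the penalty forces feasibility of the limit
  have hGz : G x' = z := by
    have hbound : ∀ k, ‖G (p (ψ k)).1 - (p (ψ k)).2‖ ^ 2 ≤ ‖ξ‖ * δ * (1 / ((ψ k : ℝ) + 1)) := by
      intro k
      rw [mul_one_div, le_div_iff₀ (by positivity)]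
      have h1 := hle0 (ψ k)
      have h2 := real_inner_le_norm ξ ((p (ψ k)).1 - x)
      have h3 : ‖(p (ψ k)).1 - x‖ ≤ δ := by simpa [dist_eq_norm] using (hpK (ψ k)).1
      have h4 := mul_le_mul_of_nonneg_left h3 (norm_nonneg ξ)
      have h5 : 0 ≤ 2 * ε * ‖(p (ψ k)).1 - x‖ := by positivity
      simp only [φ] at h1
      linarith
    have hz := le_of_tendsto_of_tendsto' hGlim ((tendsto_one_div_add_atTop_nhds_zero_nat.comp
      hψ.tendsto_atTop).const_mul (‖ξ‖ * δ)) hbound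
    rw [mul_zero] at hz
    exact sub_eq_zero.1 (norm_eq_zero.1 (pow_eq_zero_iff two_ne_zero |>.1
      (le_antisymm hz (by positivity))))
  have hx' : x' = x := by
    have h1 : -inner ℝ ξ (x' - x) + 2 * ε * ‖x' - x‖ ≤ 0 := by
      have hc : Continuous fun x' : X => -inner ℝ ξ (x' - x) + 2 * ε * ‖x' - x‖ := by fun_prop
      refine le_of_tendsto' ((hc.tendsto x').comp hlim1) fun k => ?_
      have := hle0 (ψ k)
      simp only [φ] at this
      have h5 : 0 ≤ ((ψ k : ℝ) + 1) * ‖G (p (ψ k)).1 - (p (ψ k)).2‖ ^ 2 := by positivity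
      simp only [Function.comp_apply]
      linarith
    have h2 : inner ℝ ξ (x' - x) ≤ ε * ‖x' - x‖ :=
      (hball hlimK.1).2 (show G x' ∈ P from hGz ▸ hlimK.2.1)
    have h3 : ε * ‖x' - x‖ ≤ ε * 0 := by linarith
    have h4 := le_of_mul_le_mul_left h3 hε
    exact sub_eq_zero.1 (norm_le_zero_iff.1 h4)
  subst hGz
  subst hx'
  refine hlim.frequently (Eventually.frequently ?_)
  have hnear : ∀ᶠ k in atTop, (p (ψ k)).1 ∈ Metric.ball x' δ ∧
      (p (ψ k)).2 ∈ Metric.ball (G x') 1 := by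
    have := hlim.eventually ((Metric.isOpen_ball.prod Metric.isOpen_ball).mem_nhds
      (⟨Metric.mem_ball_self hδ, Metric.mem_ball_self one_pos⟩ :
        (x', G x') ∈ Metric.ball x' δ ×ˢ Metric.ball (G x') 1))
    exact this
  filter_upwards [hnear] with k hk
  simp only [Function.comp_apply]
  have hmin := hp (ψ k)
  have hmem := hpK (ψ k)
  generalize (ψ k) = j at hk hmin hmem ⊢
  generalize p j = w at hk hmin hmem ⊢
  obtain ⟨y, z⟩ := w
  refine ⟨(2 * (j + 1 : ℝ)) • (G y - z),
    smul_sub_mem_regularNormalCone (by positivity) hmem.2.1 ?_, ?_⟩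
  · filter_upwards [nhdsWithin_le_nhds (Metric.isOpen_ball.mem_nhds hk.2), self_mem_nhdsWithin]
      with z' hz' hz'P
    have h1 : φ j (y, z) ≤ φ j (y, z') := hmin (show (y, z') ∈ K from
      ⟨hmem.1, hz'P, Metric.ball_subset_closedBall hz'⟩)
    simp only [φ, add_le_add_iff_left] at h1
    exact le_of_mul_le_mul_left h1 (by positivity)
  · have hd : DifferentiableAt ℝ G y := (hball hmem.1).1
    refine norm_le_of_forall_le_add (x := y)
      (g := fun y' => -inner ℝ ξ (y' - x') + (j + 1) * ‖G y' - z‖ ^ 2) ?_ (by positivity) ?_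
    · have h1 : HasFDerivAt (fun y' : X => -inner ℝ ξ (y' - x')) (-innerSL ℝ ξ) y :=
        ((innerSL ℝ ξ).hasFDerivAt.comp y ((hasFDerivAt_id y).sub_const x')).neg
      have h2 := ((hd.hasFDerivAt.sub_const z).norm_sq).const_mul (j + 1 : ℝ)
      refine (h1.add h2).congr_fderiv ?_
      ext h
      simp [ContinuousLinearMap.adjoint_inner_left]
      ring
    · filter_upwards [Metric.isOpen_ball.mem_nhds hk.1] with y' hy'
      have h1 : φ j (y, z) ≤ φ j (y', z) := hmin (show (y', z) ∈ K from
        ⟨Metric.ball_subset_closedBall hy', hmem.2⟩)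
      simp only [φ] at h1
      have h2 : ‖y' - x'‖ ≤ ‖y' - y‖ + ‖y - x'‖ := norm_sub_le_norm_sub_add_norm_sub _ _ _
      nlinarith

/-- Under metric regularity, both the regular normals `ξ` to the preimage `G ⁻¹' P` and the images
`(DG)ᵀ η` of limiting normals `η` to `P` are approximated by images of regular normals to `P`, with
multipliers bounded in terms of the modulus `κ` and `‖ξ‖`. -/
lemma exists_bounded_approx_multiplier {G : X → Y} {P : Set Y} {κ : ℝ} (hP : IsClosed P) {x ξ : X}
    (h : MetricallyRegularAround (fun x' => {y | ∃ z ∈ P, y = G x' - z}) κ x 0)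
    (hG : ∀ᶠ x' in 𝓝 x, DifferentiableAt ℝ G x') (hG' : ContinuousAt (fderiv ℝ G) x)
    (hξ : ξ ∈ regularNormalCone x {x' | G x' ∈ P} ∨
      ∃ η ∈ limitingNormalCone (G x) P, ContinuousLinearMap.adjoint (fderiv ℝ G x) η = ξ)
    {ε : ℝ} (hε : 0 < ε) :
    ∃ z, ∃ ζ ∈ regularNormalCone z P, ‖z - G x‖ < ε ∧
      ‖ContinuousLinearMap.adjoint (fderiv ℝ G x) ζ - ξ‖ < ε ∧ ‖ζ‖ ≤ κ * (‖ξ‖ + ε) := by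
  have hκ : 0 < κ := h.1
  have hbound := norm_le_of_metricallyRegularAround h hG
  have hnear : ∀ᶠ p : X × Y in 𝓝 (x, G x), ‖p.2 - G x‖ < ε := by
    have : Continuous fun p : X × Y => ‖p.2 - G x‖ := by fun_prop
    exact (this.tendsto (x, G x)).eventually_lt_const (by simpa using hε)
  rcases hξ with hξ | ⟨η, ⟨-, z, ζ, hz, hζ, hmem⟩, rfl⟩
  · have hA : ∀ᶠ p : X × Y in 𝓝 (x, G x),
        ‖fderiv ℝ G p.1 - fderiv ℝ G x‖ * (κ * (‖ξ‖ + ε)) < ε / 2 := by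
      have h1 : ContinuousAt (fun p : X × Y =>
          ‖fderiv ℝ G p.1 - fderiv ℝ G x‖ * (κ * (‖ξ‖ + ε))) (x, G x) :=
        ((hG'.comp_of_eq continuousAt_fst rfl).sub continuousAt_const).norm.mul continuousAt_const
      exact h1.eventually_lt_const (by simpa using half_pos hε)
    obtain ⟨⟨x', z⟩, ⟨ζ, hζ, happrox⟩, hb, hn, hA⟩ :=
      ((exists_approx_multiplier hP hG hξ (show 0 < ε / 4 by linarith)).and_eventually
        (hbound.and (hnear.and hA))).exists
    dsimp only at hζ happrox hb hn hA
    have hζn : ‖ζ‖ ≤ κ * (‖ξ‖ + ε) := by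
      refine (hb ζ hζ).trans (mul_le_mul_of_nonneg_left ?_ hκ.le)
      have := norm_le_norm_add_norm_sub' (ContinuousLinearMap.adjoint (fderiv ℝ G x') ζ) ξ
      linarith
    refine ⟨z, ζ, hζ, hn, ?_, hζn⟩
    have h1 : ‖ContinuousLinearMap.adjoint (fderiv ℝ G x' - fderiv ℝ G x) ζ‖ ≤
        ‖fderiv ℝ G x' - fderiv ℝ G x‖ * (κ * (‖ξ‖ + ε)) := by
      refine (ContinuousLinearMap.le_opNorm _ _).trans ?_
      rw [LinearIsometryEquiv.norm_map]
      gcongr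
    have h2 : ContinuousLinearMap.adjoint (fderiv ℝ G x) ζ - ξ =
        (ContinuousLinearMap.adjoint (fderiv ℝ G x') ζ - ξ) -
          ContinuousLinearMap.adjoint (fderiv ℝ G x' - fderiv ℝ G x) ζ := by
      rw [map_sub, _root_.sub_apply]
      abel
    rw [h2]
    refine (norm_sub_le _ _).trans_lt ?_
    linarith
  · have hlim : Tendsto (fun k => (x, z k)) atTop (𝓝 (x, G x)) := tendsto_const_nhds.prodMk_nhds hz
    have hζ' : Tendsto (fun k => ContinuousLinearMap.adjoint (fderiv ℝ G x) (ζ k)) atTop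
        (𝓝 (ContinuousLinearMap.adjoint (fderiv ℝ G x) η)) :=
      ((ContinuousLinearMap.adjoint (fderiv ℝ G x)).continuous.tendsto _).comp hζ
    obtain ⟨k, ⟨hb, hn⟩, hk⟩ := ((hlim.eventually (hbound.and hnear)).and
      ((tendsto_iff_norm_sub_tendsto_zero.1 hζ').eventually_lt_const hε)).exists
    refine ⟨z k, ζ k, hmem k, hn, hk, (hb _ (hmem k)).trans (mul_le_mul_of_nonneg_left ?_ hκ.le)⟩
    have := norm_le_norm_add_norm_sub' (ContinuousLinearMap.adjoint (fderiv ℝ G x) (ζ k))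
      (ContinuousLinearMap.adjoint (fderiv ℝ G x) η)
    linarith

end Multipliers

/-! ### Expansions with a parameter -/

section Expansion

/-- A property that holds near `(x₀, ω₀)` holds, for `(x, ω)` near `(x₀, ω₀)`, at `(x', ω)` for all
`x'` in a ball around `x₀` that contains `x`. -/
lemma eventually_exists_ball {X Ω : Type*} [PseudoMetricSpace X] [TopologicalSpace Ω] {x₀ : X}
    {ω₀ : Ω} {p : X × Ω → Prop} (h : ∀ᶠ z in 𝓝 (x₀, ω₀), p z) :
    ∀ᶠ z : X × Ω in 𝓝 (x₀, ω₀), ∃ δ > 0, z.1 ∈ Metric.ball x₀ δ ∧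
      ∀ x ∈ Metric.ball x₀ δ, p (x, z.2) := by
  rw [nhds_prod_eq] at h ⊢
  obtain ⟨s, hs, t, ht, hst⟩ := mem_prod_iff.1 h
  obtain ⟨δ, hδ, hball⟩ := Metric.mem_nhds_iff.1 hs
  filter_upwards [prod_mem_prod (Metric.ball_mem_nhds x₀ hδ) ht] with z hz
  exact ⟨δ, hδ, hz.1, fun x hx => hst ⟨hball hx, hz.2⟩⟩

variable {X Z Ω ι : Type*} [NormedAddCommGroup X] [NormedSpace ℝ X] [NormedAddCommGroup Z]
  [NormedSpace ℝ Z] [TopologicalSpace Ω] {g : X → Ω → Z} {x₀ : X} {ω₀ : Ω}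

lemma tendsto_clm_apply {l : Filter ι} {B : ι → X →L[ℝ] Z} {B₀ : X →L[ℝ] Z} {f : ι → X} {f₀ : X}
    (hB : Tendsto B l (𝓝 B₀)) (hf : Tendsto f l (𝓝 f₀)) :
    Tendsto (fun k => B k (f k)) l (𝓝 (B₀ f₀)) :=
  (isBoundedBilinearMap_apply.continuous.tendsto (B₀, f₀)).comp (hB.prodMk_nhds hf)

lemma eventually_norm_sub_sub_le (hg : ∀ᶠ z in 𝓝 (x₀, ω₀), DifferentiableAt ℝ (g · z.2) z.1)
    (hc : ContinuousAt (fun z : X × Ω => fderiv ℝ (g · z.2) z.1) (x₀, ω₀)) {ε : ℝ} (hε : 0 < ε) :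
    ∀ᶠ z in 𝓝 (x₀, ω₀), ‖g z.1 z.2 - g x₀ z.2 - fderiv ℝ (g · ω₀) x₀ (z.1 - x₀)‖ ≤
      ε * ‖z.1 - x₀‖ := by
  have hc' : ∀ᶠ z : X × Ω in 𝓝 (x₀, ω₀), ‖fderiv ℝ (g · z.2) z.1 - fderiv ℝ (g · ω₀) x₀‖ < ε :=
    (tendsto_iff_norm_sub_tendsto_zero.1 hc.tendsto).eventually_lt_const hε
  filter_upwards [eventually_exists_ball (hg.and hc')] with z ⟨δ, hδ, hz, hball⟩
  exact (convex_ball x₀ δ).norm_image_sub_le_of_norm_fderiv_le' (f := (g · z.2))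
    (fun x hx => (hball x hx).1) (fun x hx => (hball x hx).2.le) (Metric.mem_ball_self hδ) hz

/-- Second-order expansion in `x` at `x₀`, uniform in the parameter. It is derived along
segments, so that symmetry of the second derivative plays no role. -/
lemma eventually_norm_sub_sub_sub_le
    (hg : ∀ᶠ z in 𝓝 (x₀, ω₀), DifferentiableAt ℝ (g · z.2) z.1)
    (hg' : ∀ᶠ z in 𝓝 (x₀, ω₀), DifferentiableAt ℝ (fun x => fderiv ℝ (g · z.2) x) z.1)
    (hc : ContinuousAt (fun z : X × Ω => fderiv ℝ (fun x => fderiv ℝ (g · z.2) x) z.1) (x₀, ω₀))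
    {ε : ℝ} (hε : 0 < ε) :
    ∀ᶠ z in 𝓝 (x₀, ω₀), ‖g z.1 z.2 - g x₀ z.2 - fderiv ℝ (g · z.2) x₀ (z.1 - x₀) -
      (1 / 2 : ℝ) • fderiv ℝ (fun x => fderiv ℝ (g · ω₀) x) x₀ (z.1 - x₀) (z.1 - x₀)‖ ≤
      ε * ‖z.1 - x₀‖ ^ 2 := by
  filter_upwards [eventually_exists_ball (hg.and (eventually_norm_sub_sub_le
    (g := fun x ω => fderiv ℝ (g · ω) x) hg' hc hε))] with ⟨x, ω⟩ ⟨δ, hδ, hz, hball⟩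
  dsimp only at hz hball ⊢
  set d := x - x₀ with hd
  set D := fderiv ℝ (fun x => fderiv ℝ (g · ω₀) x) x₀
  let φ : ℝ → Z := fun s =>
    g (x₀ + s • d) ω - s • fderiv ℝ (g · ω) x₀ d - (s ^ 2 / 2) • D d d
  have hmem : ∀ s ∈ Set.Icc (0 : ℝ) 1, x₀ + s • d ∈ Metric.ball x₀ δ := by
    intro s hs
    rw [Metric.mem_ball, dist_eq_norm] at hz ⊢
    rw [add_sub_cancel_left, norm_smul, Real.norm_eq_abs, abs_of_nonneg hs.1]
    exact (mul_le_of_le_one_left (norm_nonneg _) hs.2).trans_lt hz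
  have hφ : ∀ s ∈ Set.Icc (0 : ℝ) 1, HasDerivWithinAt φ
      (fderiv ℝ (g · ω) (x₀ + s • d) d - fderiv ℝ (g · ω) x₀ d - s • D d d)
      (Set.Icc 0 1) s := by
    intro s hs
    have h1 : HasDerivAt (fun s : ℝ => x₀ + s • d) d s := by
      simpa using ((hasDerivAt_id s).smul_const d).const_add x₀
    have h2 := (hball _ (hmem s hs)).1.hasFDerivAt.comp_hasDerivAt s h1
    have h3 : HasDerivAt (fun s : ℝ => s • fderiv ℝ (g · ω) x₀ d) (fderiv ℝ (g · ω) x₀ d) s := by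
      simpa using (hasDerivAt_id s).smul_const (fderiv ℝ (g · ω) x₀ d)
    have h4 : HasDerivAt (fun s : ℝ => (s ^ 2 / 2) • D d d) (s • D d d) s := by
      have : HasDerivAt (fun s : ℝ => s ^ 2 / 2) s s := by
        simpa using ((hasDerivAt_id s).pow 2).div_const 2
      exact this.smul_const _
    exact ((h2.sub h3).sub h4).hasDerivWithinAt
  have hbound : ∀ s ∈ Set.Icc (0 : ℝ) 1,
      ‖fderiv ℝ (g · ω) (x₀ + s • d) d - fderiv ℝ (g · ω) x₀ d - s • D d d‖ ≤ ε * ‖d‖ ^ 2 := by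
    intro s hs
    have h1 := (hball _ (hmem s hs)).2
    rw [add_sub_cancel_left, norm_smul, Real.norm_eq_abs, abs_of_nonneg hs.1] at h1
    have h2 := ContinuousLinearMap.le_of_opNorm_le _ h1 d
    simp only [_root_.sub_apply, map_smul, _root_.smul_apply] at h2
    refine h2.trans ?_
    have := mul_le_of_le_one_left (norm_nonneg d) hs.2
    rw [mul_assoc, pow_two]
    gcongr
  have := (convex_Icc (0 : ℝ) 1).norm_image_sub_le_of_norm_hasDerivWithin_le hφ hbound
    (Set.left_mem_Icc.2 zero_le_one) (Set.right_mem_Icc.2 zero_le_one)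
  simp only [φ, one_smul, zero_smul, sub_zero, norm_one, mul_one, add_zero] at this
  convert this using 2
  simp [hd]
  abel

variable {l : Filter ι} {x : ι → X} {ω : ι → Ω} {u : X}

/-- Difference quotients of `g` along `(x, ω) → (x₀, ω₀)`, if the directions `x - x₀` converge
to `u` and the perturbation of `g x₀` is of smaller order than `‖x - x₀‖`. -/
lemma tendsto_smul_sub
    (hlim : Tendsto (fun k => (x k, ω k)) l (𝓝 (x₀, ω₀)))
    (hg : ∀ᶠ z in 𝓝 (x₀, ω₀), DifferentiableAt ℝ (g · z.2) z.1)
    (hc : ContinuousAt (fun z : X × Ω => fderiv ℝ (g · z.2) z.1) (x₀, ω₀))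
    (hu : Tendsto (fun k => ‖x k - x₀‖⁻¹ • (x k - x₀)) l (𝓝 u))
    (hg₀ : Tendsto (fun k => ‖x k - x₀‖⁻¹ • (g x₀ (ω k) - g x₀ ω₀)) l (𝓝 0)) :
    Tendsto (fun k => ‖x k - x₀‖⁻¹ • (g (x k) (ω k) - g x₀ ω₀)) l
      (𝓝 (fderiv ℝ (g · ω₀) x₀ u)) := by
  have hrem : Tendsto (fun k => ‖x k - x₀‖⁻¹ •
      (g (x k) (ω k) - g x₀ (ω k) - fderiv ℝ (g · ω₀) x₀ (x k - x₀))) l (𝓝 0) := by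
    rw [NormedAddGroup.tendsto_nhds_zero]
    intro ε hε
    filter_upwards [hlim.eventually (eventually_norm_sub_sub_le hg hc (half_pos hε))] with k hk
    rw [norm_smul, norm_inv, norm_norm, inv_mul_eq_div]
    refine (div_le_of_le_mul₀ (norm_nonneg _) (half_pos hε).le hk).trans_lt (half_lt_self hε)
  have h1 := (hrem.add hg₀).add (((fderiv ℝ (g · ω₀) x₀).continuous.tendsto u).comp hu)
  simp only [zero_add] at h1
  refine h1.congr fun k => ?_
  simp only [Function.comp_apply, map_smul, ← smul_add]
  congr 1
  abel

/-- Second-order counterpart of `tendsto_smul_sub`; the perturbation of `g x₀` has to be of smaller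
order than `‖x - x₀‖ ^ 2`. -/
lemma tendsto_smul_sub_sub
    (hlim : Tendsto (fun k => (x k, ω k)) l (𝓝 (x₀, ω₀)))
    (hg : ∀ᶠ z in 𝓝 (x₀, ω₀), DifferentiableAt ℝ (g · z.2) z.1)
    (hg' : ∀ᶠ z in 𝓝 (x₀, ω₀), DifferentiableAt ℝ (fun x => fderiv ℝ (g · z.2) x) z.1)
    (hc : ContinuousAt (fun z : X × Ω => fderiv ℝ (fun x => fderiv ℝ (g · z.2) x) z.1) (x₀, ω₀))
    (hu : Tendsto (fun k => ‖x k - x₀‖⁻¹ • (x k - x₀)) l (𝓝 u))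
    (hg₀ : Tendsto (fun k => (‖x k - x₀‖ ^ 2)⁻¹ • (g x₀ (ω k) - g x₀ ω₀)) l (𝓝 0))
    (hg₁ : Tendsto (fun k => ‖x k - x₀‖⁻¹ • (fderiv ℝ (g · (ω k)) x₀ - fderiv ℝ (g · ω₀) x₀)) l
      (𝓝 0)) :
    Tendsto (fun k => (‖x k - x₀‖ ^ 2)⁻¹ • (g (x k) (ω k) - g x₀ ω₀ -
      fderiv ℝ (g · ω₀) x₀ (x k - x₀))) l
      (𝓝 ((1 / 2 : ℝ) • fderiv ℝ (fun x => fderiv ℝ (g · ω₀) x) x₀ u u)) := by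
  set D := fderiv ℝ (fun x => fderiv ℝ (g · ω₀) x) x₀
  have hrem : Tendsto (fun k => (‖x k - x₀‖ ^ 2)⁻¹ •
      (g (x k) (ω k) - g x₀ (ω k) - fderiv ℝ (g · (ω k)) x₀ (x k - x₀) -
        (1 / 2 : ℝ) • D (x k - x₀) (x k - x₀))) l (𝓝 0) := by
    rw [NormedAddGroup.tendsto_nhds_zero]
    intro ε hε
    filter_upwards [hlim.eventually (eventually_norm_sub_sub_sub_le hg hg' hc (half_pos hε))]
      with k hk
    rw [norm_smul, norm_inv, norm_pow, norm_norm, inv_mul_eq_div]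
    refine (div_le_of_le_mul₀ (by positivity) (half_pos hε).le hk).trans_lt (half_lt_self hε)
  have hDu : Tendsto (fun k => D (‖x k - x₀‖⁻¹ • (x k - x₀))) l (𝓝 (D u)) :=
    (D.continuous.tendsto u).comp hu
  have hD := (tendsto_clm_apply hDu hu).const_smul (1 / 2 : ℝ)
  have h1 := ((hrem.add hg₀).add (tendsto_clm_apply hg₁ hu)).add hD
  simp only [zero_add, _root_.zero_apply] at h1
  refine h1.congr fun k => ?_
  generalize x k - x₀ = d
  simp only [map_smul, _root_.smul_apply, _root_.sub_apply, smul_smul, smul_sub,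
    pow_two, mul_inv]
  module

end Expansion

/-! ### The Hessian of the scalarized constraint -/

section Hessian

variable {n m : ℕ} {Ω : Type*}

lemma scalarizedHessian_eq {q : Vec n → Ω → Vec m} {x₀ : Vec n} {ω₀ : Ω}
    (hq : ∀ᶠ x in 𝓝 x₀, DifferentiableAt ℝ (q · ω₀) x)
    (hq' : DifferentiableAt ℝ (fun x => partialDeriv q x ω₀) x₀) (η : Vec m) (u : Vec n) :
    scalarizedHessian q η x₀ ω₀ u = ContinuousLinearMap.adjoint (partialDeriv₂ q x₀ ω₀ u) η := by
  have hgrad : (gradient fun x => (inner ℝ η (q x ω₀) : ℝ)) =ᶠ[𝓝 x₀]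
      fun x => ContinuousLinearMap.adjoint (partialDeriv q x ω₀) η := by
    filter_upwards [hq] with x hx
    refine HasGradientAt.gradient ?_
    rw [hasGradientAt_iff_hasFDerivAt]
    refine ((innerSL ℝ η).hasFDerivAt.comp x hx.hasFDerivAt).congr_fderiv ?_
    ext h
    simp [partialDeriv, ContinuousLinearMap.adjoint_inner_left]
  let T : (Vec n →L[ℝ] Vec m) →ₗ[ℝ] Vec n :=
    { toFun := fun A => ContinuousLinearMap.adjoint A η
      map_add' := fun A B => by simp
      map_smul' := fun c A => by simp }
  have hT : HasFDerivAt (fun x => ContinuousLinearMap.adjoint (partialDeriv q x ω₀) η)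
      (T.toContinuousLinearMap.comp (partialDeriv₂ q x₀ ω₀)) x₀ :=
    T.toContinuousLinearMap.hasFDerivAt.comp x₀ hq'.hasFDerivAt
  rw [scalarizedHessian, hgrad.fderiv_eq, hT.fderiv]
  rfl

end Hessian

/-! ### Critical directions along an ultrafilter -/

lemma Ultrafilter.exists_tendsto_of_eventually_norm_le {ι E : Type*} [NormedAddCommGroup E]
    [NormedSpace ℝ E] [FiniteDimensional ℝ E] (l : Ultrafilter ι) {f : ι → E} {R : ℝ}
    (h : ∀ᶠ k in (l : Filter ι), ‖f k‖ ≤ R) : ∃ y, Tendsto f l (𝓝 y) := by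
  have := FiniteDimensional.proper ℝ E
  obtain ⟨y, -, hy⟩ := (isCompact_closedBall (0 : E) R).ultrafilter_le_nhds' (l.map f)
    (Ultrafilter.mem_map.2 (h.mono fun k hk => by simpa using hk))
  exact ⟨y, hy⟩

section Critical

variable {n m p : ℕ} {Ω ι : Type*} [TopologicalSpace Ω]

/-- Rescaling along an ultrafilter. The limits `u` of `(x - x₀) / t` and `η` of the approximate
multipliers `ζ`, with `t = ‖x - x₀‖`, satisfy the first-order conditions. For the others, `ζ` lies
in a fixed polyhedral cone `C`, and the required `μ` and `v` exist because the rescaled equations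
express a limit of points in a linear image of a polyhedral cone, which is closed. -/
theorem exists_criticalTriple {F : Vec n → Ω → Vec n} {q : Vec n → Ω → Vec m}
    {r : Fin p → ℕ} {a : (i : Fin p) → Fin (r i) → Vec m} {b : (i : Fin p) → Fin (r i) → ℝ}
    {P : Set (Vec m)} (hP : P = ⋃ i, polyhedron (a i) (b i)) {x₀ : Vec n} {ω₀ : Ω}
    (hbasic : BasicAssumption F q x₀ ω₀) (hx₀ : x₀ ∈ feasibleSet q P ω₀)
    (l : Ultrafilter ι) {x : ι → Vec n} {ω : ι → Ω}
    (hlim : Tendsto (fun k => (x k, ω k)) l (𝓝 (x₀, ω₀)))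
    (hne : ∀ᶠ k in (l : Filter ι), x k ≠ x₀)
    (hF₀ : Tendsto (fun k => ‖x k - x₀‖⁻¹ • (F x₀ (ω k) - F x₀ ω₀)) l (𝓝 0))
    (hA₀ : Tendsto (fun k => ‖x k - x₀‖⁻¹ •
      (partialDeriv q x₀ (ω k) - partialDeriv q x₀ ω₀)) l (𝓝 0))
    (hq₀ : Tendsto (fun k => ‖x k - x₀‖⁻¹ • (q x₀ (ω k) - q x₀ ω₀)) l (𝓝 0))
    {R : ℝ} (hmult : ∀ᶠ k in (l : Filter ι), ∃ z, ∃ ζ ∈ regularNormalCone z P,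
      ‖z - q (x k) (ω k)‖ < ‖x k - x₀‖ ^ 3 ∧
      ‖F (x k) (ω k) + partialDerivT q (x k) (ω k) ζ‖ < ‖x k - x₀‖ ^ 3 ∧ ‖ζ‖ ≤ R) :
    ∃ u η μ, CriticalTriple F q P x₀ ω₀ u η μ ∧
      (Tendsto (fun k => (‖x k - x₀‖ ^ 2)⁻¹ • (q x₀ (ω k) - q x₀ ω₀)) l (𝓝 0) →
        ∃ v, SecondOrderTangency F q (fun i => polyhedron (a i) (b i)) x₀ ω₀ u η v) := by
  obtain ⟨U, hU, W, hW, hdiff, hFc, hqc, hFc', hqc', hqc'', -⟩ := hbasic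
  have hUW : ∀ᶠ z : Vec n × Ω in 𝓝 (x₀, ω₀), z.1 ∈ U ∧ z.2 ∈ W := prod_mem_nhds hU hW
  have hdF : ∀ᶠ z in 𝓝 (x₀, ω₀), DifferentiableAt ℝ (F · z.2) z.1 :=
    hUW.mono fun z hz => (hdiff _ hz.1 _ hz.2).1
  have hdq : ∀ᶠ z in 𝓝 (x₀, ω₀), DifferentiableAt ℝ (q · z.2) z.1 :=
    hUW.mono fun z hz => (hdiff _ hz.1 _ hz.2).2.1
  have hdq' : ∀ᶠ z in 𝓝 (x₀, ω₀), DifferentiableAt ℝ (partialDeriv q · z.2) z.1 :=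
    hUW.mono fun z hz => (hdiff _ hz.1 _ hz.2).2.2
  have hHess : ∀ η u, scalarizedHessian q η x₀ ω₀ u =
      ContinuousLinearMap.adjoint (partialDeriv₂ q x₀ ω₀ u) η :=
    scalarizedHessian_eq (eventually_of_mem hU fun x hx => (hdiff x hx ω₀ (mem_of_mem_nhds hW)).2.1)
      hdq'.self_of_nhds
  set A := partialDeriv q x₀ ω₀ with hA
  set D := partialDeriv₂ q x₀ ω₀ with hD
  set y₀ := q x₀ ω₀ with hy₀
  set t : ι → ℝ := fun k => ‖x k - x₀‖ with ht
  have ht0 : Tendsto t l (𝓝 0) := by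
    have h1 : Tendsto x l (𝓝 x₀) := (continuous_fst.tendsto _).comp hlim
    exact tendsto_iff_norm_sub_tendsto_zero.1 h1
  have htpos : ∀ᶠ k in (l : Filter ι), 0 < t k :=
    hne.mono fun k hk => norm_pos_iff.2 (sub_ne_zero.2 hk)
  -- the limit direction
  obtain ⟨u, hu⟩ := Ultrafilter.exists_tendsto_of_eventually_norm_le l
    (f := fun k => (t k)⁻¹ • (x k - x₀)) (R := 1) <| htpos.mono fun k hk => by
      rw [norm_smul, norm_inv, Real.norm_of_nonneg hk.le, inv_mul_cancel₀ hk.ne']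
  have hu1 : ‖u‖ = 1 := by
    refine tendsto_nhds_unique hu.norm ((tendsto_const_nhds (x := (1 : ℝ))).congr' ?_)
    filter_upwards [htpos] with k hk
    rw [norm_smul, norm_inv, Real.norm_of_nonneg hk.le, inv_mul_cancel₀ hk.ne']
  have hFu := tendsto_smul_sub hlim hdF hFc' hu hF₀
  have hqu := tendsto_smul_sub hlim hdq hqc' hu hq₀
  have hAu := tendsto_smul_sub (g := partialDeriv q) hlim hdq' hqc'' hu hA₀
  change Tendsto (fun k => (t k)⁻¹ • (q (x k) (ω k) - y₀)) l (𝓝 (A u)) at hqu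
  change Tendsto (fun k => (t k)⁻¹ • (partialDeriv q (x k) (ω k) - A)) l (𝓝 (D u)) at hAu
  -- the approximate multipliers and their limit
  obtain ⟨z, hz⟩ := hmult.choice
  obtain ⟨ζ, hζ⟩ := hz.choice
  have hζmem : ∀ᶠ k in (l : Filter ι), ζ k ∈ regularNormalCone (z k) P := hζ.mono fun k hk => hk.1
  obtain ⟨η, hη⟩ := Ultrafilter.exists_tendsto_of_eventually_norm_le l (f := ζ) (R := R)
    (hζ.mono fun k hk => hk.2.2.2)
  have hzq : Tendsto (fun k => ((t k) ^ 2)⁻¹ • (z k - q (x k) (ω k))) l (𝓝 0) := by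
    refine squeeze_zero_norm' ?_ ht0
    filter_upwards [hζ, htpos] with k hk hk0
    rw [norm_smul, norm_inv, norm_pow, Real.norm_of_nonneg hk0.le, inv_mul_le_iff₀ (by positivity)]
    exact hk.2.1.le.trans_eq (by ring)
  have hres : Tendsto (fun k => (t k)⁻¹ •
      (F (x k) (ω k) + partialDerivT q (x k) (ω k) (ζ k))) l (𝓝 0) := by
    refine squeeze_zero_norm' ?_ (by simpa using ht0.pow 2)
    filter_upwards [hζ, htpos] with k hk hk0
    rw [norm_smul, norm_inv, Real.norm_of_nonneg hk0.le, inv_mul_le_iff₀ hk0]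
    exact hk.2.2.1.le.trans_eq (by ring)
  have hzu : Tendsto (fun k => (t k)⁻¹ • (z k - y₀)) l (𝓝 (A u)) := by
    have h1 := (ht0.smul hzq).add hqu
    rw [zero_smul, zero_add] at h1
    refine h1.congr' ?_
    filter_upwards [htpos] with k hk
    rw [smul_smul, pow_two, mul_inv, mul_inv_cancel_left₀ hk.ne', ← smul_add]
    congr 1
    abel
  have hzlim : Tendsto z l (𝓝 y₀) := by
    have h1 := (ht0.smul hzu).add_const y₀
    rw [zero_smul, zero_add] at h1
    refine h1.congr' ?_
    filter_upwards [htpos] with k hk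
    rw [smul_inv_smul₀ hk.ne', sub_add_cancel]
  -- all quantities below are within `ε` of their limits for some index at which `p` holds
  have hfreq : ∀ {p : ι → Prop}, (∀ᶠ k in (l : Filter ι), p k) → ∀ ε > 0, ∃ k, p k ∧ 0 < t k ∧
      t k < ε ∧ ‖(t k)⁻¹ • (z k - y₀) - A u‖ < ε ∧ y₀ + t k • (t k)⁻¹ • (z k - y₀) = z k := by
    intro p hp ε hε
    obtain ⟨k, hk1, hk2, hk3, hk4⟩ := (hp.and (htpos.and ((ht0.eventually_lt_const hε).and
      ((tendsto_iff_norm_sub_tendsto_zero.1 hzu).eventually_lt_const hε)))).exists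
    exact ⟨k, hk1, hk2, hk3, hk4, by rw [smul_inv_smul₀ hk2.ne', add_sub_cancel]⟩
  -- the regular normal cones at `z k` eventually equal a fixed polyhedral cone `C`
  have hzP : ∀ᶠ k in (l : Filter ι), z k ∈ P := hζmem.mono fun k hk => hk.1
  obtain ⟨C, hCmem, hC⟩ := (Ultrafilter.eventually_exists_mem_iff (f := l)
    (P := fun C k => C = regularNormalCone (z k) P)
    (finite_regularNormalCones (a := a) (b := b))).1
    (hzP.mono fun k hk => ⟨_, ⟨z k, hP ▸ hk, by rw [hP]⟩, rfl⟩)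
  have hCpoly : IsPolyhedralCone C := by
    obtain ⟨z', hz', rfl⟩ := hCmem
    exact isPolyhedralCone_regularNormalCone hz'
  have hCdir : C ⊆ directionalNormalCone y₀ P (A u) := by
    intro ξ hξ
    refine mem_directionalNormalCone_of_forall_pos hx₀ fun ε hε => ?_
    obtain ⟨k, hk, htk, htε, hwk, hzk⟩ := hfreq hC ε hε
    refine ⟨t k, _, ξ, htk, htε, hwk, by simpa using hε, ?_⟩
    rwa [hzk, ← hk]
  have hζC : ∀ᶠ k in (l : Filter ι), ζ k ∈ C := by
    filter_upwards [hC, hζmem] with k h1 h2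
    rwa [h1]
  have hηC : η ∈ C := hCpoly.isClosed.mem_of_tendsto hη hζC
  -- the piece of `P` containing `z k` is eventually fixed as well
  obtain ⟨i, hi⟩ := (Ultrafilter.eventually_exists_iff (f := l)
    (P := fun i k => z k ∈ polyhedron (a i) (b i))).1
    (hzP.mono fun k hk => Set.mem_iUnion.1 (hP ▸ hk))
  have hiP : polyhedron (a i) (b i) ⊆ P :=
    hP ▸ Set.subset_iUnion (fun i => polyhedron (a i) (b i)) i
  have hy₀i : y₀ ∈ polyhedron (a i) (b i) := (isClosed_polyhedron _ _).mem_of_tendsto hzlim hi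
  have hui : A u ∈ contingentCone y₀ (polyhedron (a i) (b i)) := by
    refine mem_contingentCone_of_forall_pos hy₀i fun ε hε => ?_
    obtain ⟨k, hk, htk, htε, hwk, hzk⟩ := hfreq hi ε hε
    exact ⟨t k, _, htk, htε, hwk, by rwa [hzk]⟩
  -- passing to the limit in the stationarity equation
  have hAlim : Tendsto (fun k => partialDeriv q (x k) (ω k)) l (𝓝 A) := hqc'.tendsto.comp hlim
  have hadj : ∀ {B : ι → Vec n →L[ℝ] Vec m} {B₀ : Vec n →L[ℝ] Vec m}, Tendsto B l (𝓝 B₀) →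
      Tendsto (fun k => ContinuousLinearMap.adjoint (B k) (ζ k)) l
        (𝓝 (ContinuousLinearMap.adjoint B₀ η)) := fun hB =>
    tendsto_clm_apply ((ContinuousLinearMap.adjoint.continuous.tendsto _).comp hB) hη
  have hFOC : F x₀ ω₀ + ContinuousLinearMap.adjoint A η = 0 := by
    have h1 := ht0.smul hres
    rw [zero_smul] at h1
    refine tendsto_nhds_unique ((hFc.tendsto.comp hlim).add (hadj hAlim)) (h1.congr' ?_)
    filter_upwards [htpos] with k hk
    rw [smul_inv_smul₀ hk.ne']
    rfl
  -- `(DF) u + D²(ηᵀq) u` is the limit of the images of `-(ζ - η) / t` under `Aᵀ`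
  have hμlim : Tendsto (fun k => ContinuousLinearMap.adjoint A ((t k)⁻¹ • (ζ k - η))) l
      (𝓝 (-(partialDeriv F x₀ ω₀ u + ContinuousLinearMap.adjoint (D u) η))) := by
    have h1 := (hres.sub hFu).sub (hadj hAu)
    rw [zero_sub, ← neg_add'] at h1
    refine h1.congr fun k => ?_
    have h2 : ContinuousLinearMap.adjoint A η = -F x₀ ω₀ := (neg_eq_of_add_eq_zero_right hFOC).symm
    simp only [partialDerivT, map_smul, map_sub, h2, _root_.smul_apply, _root_.sub_apply]
    module
  obtain ⟨K, hK, hKsub, hKcone⟩ := hCpoly.exists_subset_contingentCone hηC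
  obtain ⟨μ, hμK, hμ⟩ : -(partialDeriv F x₀ ω₀ u + ContinuousLinearMap.adjoint (D u) η) ∈
      (ContinuousLinearMap.adjoint A).toLinearMap '' K := by
    refine (hK.image (ContinuousLinearMap.adjoint A).toLinearMap).isClosed.mem_of_tendsto hμlim ?_
    filter_upwards [hζC, htpos] with k h1 h2
    exact ⟨_, hK.smul_mem (hKsub _ h1) (inv_nonneg.2 h2.le), rfl⟩
  refine ⟨u, η, μ, ⟨?_, contingentCone_mono hiP hui, hCdir hηC,
    contingentCone_mono hCdir (hKcone hμK), hFOC, ?_⟩, fun hq₀' => ?_⟩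
  · rintro rfl
    simp at hu1
  · rw [hHess]
    change _ + ContinuousLinearMap.adjoint A μ = 0
    rw [show ContinuousLinearMap.adjoint A μ = _ from hμ, add_neg_cancel]
  -- `D u u` is a limit of points `w - A v` with `w` in a polyhedral cone of tangents to the `i`-th
  -- polyhedron orthogonal to `η`
  have hq2 := tendsto_smul_sub_sub hlim hdq hdq' hqc'' hu hq₀' hA₀
  change Tendsto (fun k => ((t k) ^ 2)⁻¹ • (q (x k) (ω k) - y₀ - A (x k - x₀))) l
    (𝓝 ((1 / 2 : ℝ) • D u u)) at hq2
  obtain ⟨K', hK', hK'sub, hK'cone⟩ := polyhedron_exists_subset_contingentCone hy₀i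
  let T : Vec m × Vec n →ₗ[ℝ] Vec m := LinearMap.fst ℝ _ _ - A.toLinearMap ∘ₗ LinearMap.snd ℝ _ _
  have hS : IsPolyhedralCone {w : Vec m × Vec n | w.1 ∈ K' ∧ inner ℝ η w.1 = 0} := by
    convert (hK'.preimage (LinearMap.fst ℝ (Vec m) (Vec n))).inter
      (isPolyhedralCone_setOf_eq fun _ : Unit => (innerₛₗ ℝ η) ∘ₗ LinearMap.fst ℝ (Vec m) (Vec n))
      using 1
    ext w
    simp
  have horth : ∀ᶠ k in (l : Filter ι), inner ℝ η (z k - y₀) = 0 := by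
    filter_upwards [hzlim.eventually
      (eventually_inner_regularNormalCone_eq_zero (a := a) (b := b) y₀), hC, hi] with k h1 h2 h3
    exact h1 η (hP ▸ h2 ▸ hηC) i h3
  obtain ⟨⟨w, v⟩, ⟨hwK, hwη⟩, hwv⟩ : D u u ∈
      T '' {w : Vec m × Vec n | w.1 ∈ K' ∧ inner ℝ η w.1 = 0} := by
    have h1 := (hzq.add hq2).const_smul (2 : ℝ)
    rw [zero_add, smul_smul, mul_one_div_cancel two_ne_zero, one_smul] at h1
    refine (hS.image T).isClosed.mem_of_tendsto h1 ?_
    filter_upwards [hi, horth] with k h2 h3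
    refine ⟨((2 * ((t k) ^ 2)⁻¹) • (z k - y₀), (2 * ((t k) ^ 2)⁻¹) • (x k - x₀)),
      ⟨hK'.smul_mem (hK'sub _ h2) (by positivity), ?_⟩, ?_⟩
    · rw [inner_smul_right, h3, mul_zero]
    · simp only [T, LinearMap.sub_apply, LinearMap.fst_apply, LinearMap.comp_apply,
        LinearMap.snd_apply, ContinuousLinearMap.coe_coe, map_smul]
      module
  have hwv' : A v + D u u = w := by
    rw [← hwv]
    simp [T]
  refine ⟨v, ?_, ?_⟩
  · change A v + D u u ∈ _
    rw [hwv']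
    refine contingentCone_mono ?_ (hK'cone hwK)
    exact Set.subset_biUnion_of_mem (u := fun i => polyhedron (a i) (b i)) hui
  · have h1 : F x₀ ω₀ = -ContinuousLinearMap.adjoint A η := eq_neg_of_add_eq_zero_left hFOC
    have h2 : inner ℝ η (A v + D u u) = 0 := by rw [hwv']; exact hwη
    rw [inner_add_right] at h2
    rw [hHess, h1, inner_neg_left, ContinuousLinearMap.adjoint_inner_left,
      ContinuousLinearMap.adjoint_inner_right, real_inner_comm]
    linarith

end Critical

/-! ### Failure of stability -/

section Stability

variable {n m p : ℕ} {Ω : Type*} {F : Vec n → Ω → Vec n} {q : Vec n → Ω → Vec m}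
  {P : Set (Vec m)}

/-- Solutions in the region where the constraints are metrically regular come with approximate
multipliers, bounded in terms of the modulus. -/
lemma exists_multiplier_of_mem_solutions {κ : ℝ} (hP : IsClosed P) {x : Vec n} {ω : Ω}
    (hreg : MetricallyRegularAround (constraintMap q P ω) κ x 0)
    (hdq : ∀ᶠ x' in 𝓝 x, DifferentiableAt ℝ (q · ω) x')
    (hdq' : DifferentiableAt ℝ (fun x' => partialDeriv q x' ω) x)
    (hx : x ∈ solutionsB F q P ω ∪ solutionsM F q P ω) {ε : ℝ} (hε : 0 < ε) :
    ∃ z, ∃ ζ ∈ regularNormalCone z P, ‖z - q x ω‖ < ε ∧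
      ‖F x ω + partialDerivT q x ω ζ‖ < ε ∧ ‖ζ‖ ≤ κ * (‖F x ω‖ + ε) := by
  have hξ : -F x ω ∈ regularNormalCone x {x' | q x' ω ∈ P} ∨
      ∃ η ∈ limitingNormalCone (q x ω) P,
        ContinuousLinearMap.adjoint (fderiv ℝ (q · ω) x) η = -F x ω := by
    rcases hx with ⟨ξ, hξ, h0⟩ | ⟨η, hη, h0⟩
    · exact Or.inl (neg_eq_of_add_eq_zero_right h0 ▸ hξ)
    · exact Or.inr ⟨η, hη, (neg_eq_of_add_eq_zero_right h0).symm⟩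
  obtain ⟨z, ζ, hζ, h1, h2, h3⟩ :=
    exists_bounded_approx_multiplier hP hreg hdq hdq'.continuousAt hξ hε
  refine ⟨z, ζ, hζ, h1, ?_, by simpa using h3⟩
  rwa [sub_neg_eq_add, add_comm] at h2

variable [TopologicalSpace Ω] {x₀ : Vec n} {ω₀ : Ω} {l : ℕ}

/-- If the stability estimate fails, some ultrafilter converging to `(x₀, ω₀)` lives on solutions
`x ≠ x₀` along which the error function is of smaller order than `‖x - x₀‖`. -/
lemma exists_ultrafilter_of_not_upperStable (h : ¬ UpperStable F q P x₀ ω₀ l) :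
    ∃ f : Ultrafilter (Vec n × Ω), (f : Filter (Vec n × Ω)) ≤ 𝓝 (x₀, ω₀) ∧
      (∀ᶠ z in (f : Filter (Vec n × Ω)),
        z.1 ∈ solutionsB F q P z.2 ∪ solutionsM F q P z.2 ∧ z.1 ≠ x₀) ∧
      Tendsto (fun z : Vec n × Ω => errTau F q x₀ ω₀ l z.2 / ‖z.1 - x₀‖) f (𝓝 0) := by
  have hτ : ∀ ω, 0 ≤ errTau F q x₀ ω₀ l ω := fun ω => by
    unfold errTau errE
    positivity
  let φ : Vec n × Ω → (Vec n × Ω) × ℝ := fun z => (z, errTau F q x₀ ω₀ l z.2 / ‖z.1 - x₀‖)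
  have hne : (comap φ (𝓝 ((x₀, ω₀), (0 : ℝ))) ⊓ 𝓟 {z |
      z.1 ∈ solutionsB F q P z.2 ∪ solutionsM F q P z.2 ∧ z.1 ≠ x₀}).NeBot := by
    rw [inf_principal_neBot_iff]
    intro s hs
    obtain ⟨t, ht, hts⟩ := mem_comap.1 hs
    rw [nhds_prod_eq, nhds_prod_eq] at ht
    obtain ⟨t₁, ht₁, V, hV, ht⟩ := mem_prod_iff.1 ht
    obtain ⟨U, hU, W, hW, ht₁⟩ := mem_prod_iff.1 ht₁
    obtain ⟨ε, hε, hball⟩ := Metric.mem_nhds_iff.1 hV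
    by_contra hempty
    refine h ⟨U, hU, W, hW, 2 / ε, by positivity, fun ω hω x hx => ?_⟩
    by_contra hx'
    rw [Metric.mem_closedBall, dist_eq_norm, not_le] at hx'
    have hpos : 0 < ‖x - x₀‖ := lt_of_le_of_lt (mul_nonneg (by positivity) (hτ ω)) hx'
    refine hempty ⟨(x, ω), hts (ht ⟨ht₁ ⟨hx.2, hω⟩, hball ?_⟩), hx.1,
      sub_ne_zero.1 (norm_pos_iff.1 hpos)⟩
    rw [mem_ball_zero_iff, Real.norm_of_nonneg (div_nonneg (hτ ω) hpos.le), div_lt_iff₀ hpos]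
    rw [div_mul_eq_mul_div, div_lt_iff₀ hε] at hx'
    have := mul_pos hε hpos
    linarith
  obtain ⟨f, hf⟩ := Ultrafilter.exists_le (comap φ (𝓝 ((x₀, ω₀), (0 : ℝ))) ⊓ 𝓟 {z |
    z.1 ∈ solutionsB F q P z.2 ∪ solutionsM F q P z.2 ∧ z.1 ≠ x₀})
  have hφ : Tendsto φ f (𝓝 ((x₀, ω₀), (0 : ℝ))) := tendsto_iff_comap.2 (hf.trans inf_le_left)
  exact ⟨f, (continuous_fst.tendsto _).comp hφ, le_principal_iff.1 (hf.trans inf_le_right),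
    (continuous_snd.tendsto _).comp hφ⟩

/-- Property `R_l` makes the solutions along the ultrafilter of the previous lemma approximately
M-stationary with bounded multipliers, and smallness of the error function relative to `‖x - x₀‖`
turns into the `o(‖x - x₀‖ ^ l)` bounds needed for the expansions. -/
lemma exists_criticalTriple_of_not_upperStable {r : Fin p → ℕ}
    {a : (i : Fin p) → Fin (r i) → Vec m} {b : (i : Fin p) → Fin (r i) → ℝ}
    (hP : P = ⋃ i, polyhedron (a i) (b i)) (hbasic : BasicAssumption F q x₀ ω₀)
    (hx₀ : x₀ ∈ feasibleSet q P ω₀) (hl : 1 ≤ l) (hR : PropertyR q P x₀ ω₀ l)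
    (h : ¬ UpperStable F q P x₀ ω₀ l) :
    ∃ u η μ, CriticalTriple F q P x₀ ω₀ u η μ ∧
      (l = 2 → ∃ v, SecondOrderTangency F q (fun i => polyhedron (a i) (b i)) x₀ ω₀ u η v) := by
  obtain ⟨f, hf, hsol, hτ⟩ := exists_ultrafilter_of_not_upperStable h
  have hPc : IsClosed P := hP ▸ isClosed_iUnion_of_finite fun i => isClosed_polyhedron _ _
  have hf1 : Tendsto (fun z : Vec n × Ω => z.1) f (𝓝 x₀) :=
    (continuous_fst.tendsto (x₀, ω₀)).mono_left hf
  have ht0 : Tendsto (fun z : Vec n × Ω => ‖z.1 - x₀‖) f (𝓝 0) :=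
    tendsto_iff_norm_sub_tendsto_zero.1 hf1
  have htpos : ∀ᶠ z : Vec n × Ω in (f : Filter (Vec n × Ω)), 0 < ‖z.1 - x₀‖ :=
    hsol.mono fun z hz => norm_pos_iff.2 (sub_ne_zero.2 hz.2)
  -- the error function dominates each of its terms
  have hE : ∀ ω, errE q x₀ ω₀ l ω ≤ errTau F q x₀ ω₀ l ω := fun ω =>
    le_add_of_nonneg_left (norm_nonneg _)
  have hτ0 : ∀ ω, 0 ≤ errTau F q x₀ ω₀ l ω := fun ω => by
    unfold errTau errE
    positivity
  have hτF : ∀ ω, ‖F x₀ ω - F x₀ ω₀‖ ≤ errTau F q x₀ ω₀ l ω := fun ω => by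
    unfold errTau errE
    exact le_add_of_nonneg_right (by positivity)
  have hτA : ∀ ω, ‖partialDeriv q x₀ ω - partialDeriv q x₀ ω₀‖ ≤ errTau F q x₀ ω₀ l ω :=
    fun ω => le_trans (by unfold errE; exact le_add_of_nonneg_right (by positivity)) (hE ω)
  have hτq : ∀ ω, ‖q x₀ ω - q x₀ ω₀‖ ≤ errTau F q x₀ ω₀ l ω ^ l := fun ω => by
    have h1 : ‖q x₀ ω - q x₀ ω₀‖ ^ (1 / (l : ℝ)) ≤ errTau F q x₀ ω₀ l ω :=
      le_trans (le_add_of_nonneg_left (norm_nonneg _)) (hE ω)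
    have h2 := pow_le_pow_left₀ (by positivity) h1 l
    rwa [one_div, Real.rpow_inv_natCast_pow (norm_nonneg _) (by omega)] at h2
  have hF₀ : Tendsto (fun z : Vec n × Ω => ‖z.1 - x₀‖⁻¹ • (F x₀ z.2 - F x₀ ω₀)) f (𝓝 0) := by
    refine squeeze_zero_norm (fun z => ?_) hτ
    rw [norm_smul, norm_inv, norm_norm, inv_mul_eq_div]
    gcongr
    exact hτF _
  have hA₀ : Tendsto (fun z : Vec n × Ω => ‖z.1 - x₀‖⁻¹ •
      (partialDeriv q x₀ z.2 - partialDeriv q x₀ ω₀)) f (𝓝 0) := by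
    refine squeeze_zero_norm (fun z => ?_) hτ
    rw [norm_smul, norm_inv, norm_norm, inv_mul_eq_div]
    gcongr
    exact hτA _
  have hql : Tendsto (fun z : Vec n × Ω => (‖z.1 - x₀‖ ^ l)⁻¹ • (q x₀ z.2 - q x₀ ω₀)) f (𝓝 0) := by
    have h1 := hτ.pow l
    rw [zero_pow (by omega)] at h1
    refine squeeze_zero_norm (fun z => ?_) h1
    rw [norm_smul, norm_inv, norm_pow, norm_norm, inv_mul_eq_div, div_pow]
    gcongr
    exact hτq _
  have hq₀ : Tendsto (fun z : Vec n × Ω => ‖z.1 - x₀‖⁻¹ • (q x₀ z.2 - q x₀ ω₀)) f (𝓝 0) := by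
    refine squeeze_zero_norm' ?_ (tendsto_zero_iff_norm_tendsto_zero.1 hql)
    filter_upwards [htpos, ht0.eventually_le_const one_pos] with z hz hz1
    simp only [norm_smul, norm_inv, norm_pow, norm_norm]
    gcongr
    exact pow_le_of_le_one hz.le hz1 (by omega)
  obtain ⟨U, hU, W, hW, κ, hκ, γ, hγ, hreg⟩ := hR
  obtain ⟨U', hU', W', hW', hdiff, hFc, -⟩ := id hbasic
  have hmult : ∀ᶠ z in (f : Filter (Vec n × Ω)), ∃ y, ∃ ζ ∈ regularNormalCone y P,
      ‖y - q z.1 z.2‖ < ‖z.1 - x₀‖ ^ 3 ∧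
      ‖F z.1 z.2 + partialDerivT q z.1 z.2 ζ‖ < ‖z.1 - x₀‖ ^ 3 ∧
      ‖ζ‖ ≤ κ * (‖F x₀ ω₀‖ + 1 + 1) := by
    have hFn : ∀ᶠ z in (f : Filter (Vec n × Ω)), ‖F z.1 z.2‖ < ‖F x₀ ω₀‖ + 1 :=
      (hFc.norm.eventually_lt_const (lt_add_one _)).filter_mono hf
    filter_upwards [hf (prod_mem_nhds hU hW),
      hf (prod_mem_nhds (eventually_mem_nhds_iff.2 hU') hW'),
      hsol, htpos, hFn, hτ.eventually_lt_const (inv_pos.2 hγ), ht0.eventually_le_const one_pos]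
      with z hzU hzU' hzs hz hzF hzτ hz1
    have hfeas : z.1 ∈ feasibleSet q P z.2 := by
      rcases hzs.1 with ⟨ξ, hξ, -⟩ | ⟨η, hη, -⟩
      exacts [hξ.1, hη.1]
    have hfar : γ * errE q x₀ ω₀ l z.2 < ‖z.1 - x₀‖ := by
      rw [div_lt_iff₀ hz, inv_mul_eq_div, lt_div_iff₀ hγ] at hzτ
      linarith [mul_le_mul_of_nonneg_left (hE z.2) hγ.le]
    obtain ⟨y, ζ, hζ, h1, h2, h3⟩ := exists_multiplier_of_mem_solutions (F := F) hPc
      (hreg z.2 hzU.2 z.1 ⟨hfeas, hzU.1⟩ hfar)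
      (eventually_of_mem hzU'.1 fun x hx => (hdiff x hx z.2 hzU'.2).2.1)
      (hdiff z.1 (mem_of_mem_nhds hzU'.1) z.2 hzU'.2).2.2 hzs.1 (pow_pos hz 3)
    refine ⟨y, ζ, hζ, h1, h2, h3.trans ?_⟩
    have := pow_le_one₀ (n := 3) hz.le hz1
    gcongr
  obtain ⟨u, η, μ, hcrit, hsec⟩ := exists_criticalTriple hP hbasic hx₀ f hf
    (hsol.mono fun z hz => hz.2) hF₀ hA₀ hq₀ hmult
  exact ⟨u, η, μ, hcrit, fun hl2 => hsec (by subst hl2; exact hql)⟩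

end Stability

end DisjunctiveStability

theorem mainTheorem1 {n m p : ℕ} {Ω : Type*} [TopologicalSpace Ω]
    (F : EuclideanSpace ℝ (Fin n) → Ω → EuclideanSpace ℝ (Fin n))
    (q : EuclideanSpace ℝ (Fin n) → Ω → EuclideanSpace ℝ (Fin m))
    (hF : Continuous fun z : EuclideanSpace ℝ (Fin n) × Ω => F z.1 z.2)
    (hq : Continuous fun z : EuclideanSpace ℝ (Fin n) × Ω => q z.1 z.2)
    (r : Fin p → ℕ) (a : (i : Fin p) → Fin (r i) → EuclideanSpace ℝ (Fin m))
    (b : (i : Fin p) → Fin (r i) → ℝ)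
    (P : Set (EuclideanSpace ℝ (Fin m)))
    (hP : P = ⋃ i, DisjunctiveStability.polyhedron (a i) (b i))
    (x₀ : EuclideanSpace ℝ (Fin n)) (ω₀ : Ω)
    (hbasic : DisjunctiveStability.BasicAssumption F q x₀ ω₀)
    (hx₀ : x₀ ∈ DisjunctiveStability.feasibleSet q P ω₀) :
    (DisjunctiveStability.PropertyR q P x₀ ω₀ 1 →
      (¬ ∃ u η μ, DisjunctiveStability.CriticalTriple F q P x₀ ω₀ u η μ) →
      DisjunctiveStability.UpperStable F q P x₀ ω₀ 1) ∧
    (DisjunctiveStability.PropertyR q P x₀ ω₀ 2 →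
      (¬ ∃ u η μ v, DisjunctiveStability.CriticalTriple F q P x₀ ω₀ u η μ ∧
        DisjunctiveStability.SecondOrderTangency F q
          (fun i => DisjunctiveStability.polyhedron (a i) (b i)) x₀ ω₀ u η v) →
      DisjunctiveStability.UpperStable F q P x₀ ω₀ 2) := by
  constructor
  · intro hR hno
    by_contra h
    obtain ⟨u, η, μ, hcrit, -⟩ :=
      DisjunctiveStability.exists_criticalTriple_of_not_upperStable hP hbasic hx₀ le_rfl hR h
    exact hno ⟨u, η, μ, hcrit⟩
  · intro hR hno
    by_contra h
    obtain ⟨u, η, μ, hcrit, hsec⟩ :=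
      DisjunctiveStability.exists_criticalTriple_of_not_upperStable hP hbasic hx₀ one_le_two hR h
    obtain ⟨v, hv⟩ := hsec rfl
    exact hno ⟨u, η, μ, v, hcrit, hv⟩
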